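/- Let $d\ge 1$. Let $(\Omega,\mathcal F)$ be a measurable space with a measurable flow $(\theta_s)_{s\in\mathbb R^d}$ (that is, $(\omega,s)\mapsto\theta_s\omega$ is measurable, $\theta_0=\mathrm{id}$, $\theta_s\circ\theta_t=\theta_{s+t}$), and let $\mathbb P$ be a probability measure on $\Omega$ that is invariant under all $\theta_s$ and ergodic (every event invariant under all $\theta_s$ has probability $0$ or $1$). Let $\Phi,\Psi$ be ergodic random measures on $\mathbb R^d$ on this space, that is, measurable maps from $\Omega$ to the locally finite Borel measures on $\mathbb R^d$ with $\Phi_{\theta_s\omega}(B)=\Phi_\omega(B+s)$ and $\Psi_{\theta_s\omega}(B)=\Psi_\omega(B+s)$ for all $s,\omega$ and Borel $B$. Assume that they have the same intensity $\lambda\in(0,\infty)$: $\mathbb E[\Phi(B)]=\mathbb E[\Psi(B)]=\lambda\,\mathcal L_d(B)$ for all Borel $B$, where $\mathcal L_d$ is Lebesgue measure. **Site-optimal density.** For locally finite measures $\varphi,\psi$ on $\mathbb R^d$, let $R_0:=0$ on $\mathbb R^d\times\mathbb R^d$, let $B_a(x)$ be the closed Euclidean ball, and for $n=1,2,\dots$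 define $A_n,R_n:\mathbb R^d\times\mathbb R^d\to[0,1]$ as follows. (i) Let $a_n(x):=\sup\{a\ge 0:\int_{B_a(x)}(1-R_{n-1}(x,\xi))\,\psi(d\xi)\le 1\}\in[0,\infty]$ (with $\sup\emptyset=0$), and let $A_n(x,\xi)$ be $1$ if $|x-\xi|<a_n(x)$, $cR_{n-1}(x,\xi)+(1-c)$ if $|x-\xi|=a_n(x)$, and $0$ if $|x-\xi|>a_n(x)$. Here $c=c_n(x)\in[0,1]$ is the constant with $\int (A_n(x,\xi)-R_{n-1}(x,\xi))\,\psi(d\xi)=1$ if $a_n(x)<\infty$ and $\int_{\{|x-\xi|=a_n(x)\}}(1-R_{n-1}(x,\xi))\,\psi(d\xi)>0$, and $c=1$ otherwise. (ii) Let $r_n(\xi):=\sup\{r\ge 0:\int_{B_r(\xi)}A_n(x,\xi)\,\varphi(dx)\le 1\}\in[0,\infty]$ (with $\sup\emptyset=0$), and let $R_n(x,\xi)$ be $0$ if $|x-\xi|<r_n(\xi)$, $c'A_n(x,\xi)$ if $|x-\xi|=r_n(\xi)$, and $A_n(x,\xi)$ if $|x-\xi|>r_n(\xi)$. Here $c'=c'_n(\xi)\in[0,1]$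 is the constant with $\int (A_n(x,\xi)-R_n(x,\xi))\,\varphi(dx)=1$ if $r_n(\xi)<\infty$ and $\int_{\{|x-\xi|=r_n(\xi)\}}A_n(x,\xi)\,\varphi(dx)>0$, and $c'=0$ otherwise. The sequences $A_n$ and $R_n$ are non-decreasing in $n$; the site-optimal density of $(\varphi,\psi)$ is $f_s:=\lim_n A_n-\lim_n R_n$. **Theorem.** Let $F_\omega$ be the site-optimal density of $(\Phi_\omega,\Psi_\omega)$. Then almost surely $F_\omega$ is a balancing constrained density, that is, it is measurable on $\mathbb R^d\times\mathbb R^d$, $0\le F_\omega\le 1$ everywhere, $\int F_\omega(x,\xi)\,\Psi_\omega(d\xi)\le 1$ for every $x$ with equality for $\Phi_\omega$-a.e. $x$, and $\int F_\omega(x,\xi)\,\Phi_\omega(dx)\le 1$ for every $\xi$ with equality for $\Psi_\omega$-a.e. $\xi$. Moreover $(\omega,x,\xi)\mapsto F_\omega(x,\xi)$ is measurable and flow-adapted, $F_{\theta_s\omega}(x,\xi)=F_\omega(x+s,\xi+s)$. Consequently $$T_\omega(x,B):=\int_B F_\omega(x,\xi)\,\Psi_\omega(d\xi)$$ is measurable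 in $(\omega,x)$, is flow-adapted, $T_{\theta_s\omega}(x,B)=T_\omega(x+s,B+s)$, and is almost surely a $(\Phi_\omega,\Psi_\omega)$-balancing transport kernel: $x\mapsto T_\omega(x,\cdot)$ is a measurable map into the locally finite measures, $T_\omega(x,\mathbb R^d)=1$ for $\Phi_\omega$-a.e. $x$, and $\int T_\omega(x,B)\,\Phi_\omega(dx)=\Psi_\omega(B)$ for every Borel $B$. -/

import Mathlib

open MeasureTheory Filter Topology Set
open scoped ENNReal NNReal

noncomputable section

namespace GaleShapley

/-- `ℝ^d` with its Euclidean distance, Borel sigma-field and Lebesgue measure `volume`. -/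
abbrev Sp (d : ℕ) : Type := EuclideanSpace ℝ (Fin d)

variable {d : ℕ}

/-! ### The site-optimal Gale-Shapley algorithm

All weights lie in `[0, 1]`; they are coded in `ℝ≥0∞`, where no subtraction below ever truncates
(`R ≤ 1`, `R_n ≤ A_n` and `R_{n-1} ≤ A_n`). Radii take values in `[0, ∞]`. -/

/-- `sup {a : ∫_{closedBall x a} w dμ ≤ 1}`, in `[0, ∞]`; the supremum is `0` when `x` itself
already carries mass greater than `1`. -/
def fillRadius (μ : Measure (Sp d)) (w : Sp d → ℝ≥0∞) (x : Sp d) : ℝ≥0∞ :=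
  ⨆ (a : ℝ≥0) (_ : ∫⁻ y in Metric.closedBall x (a : ℝ), w y ∂μ ≤ 1), (a : ℝ≥0∞)

/-- The `w μ`-mass of the open ball whose radius is `fillRadius μ w x`. -/
def innerMass (μ : Measure (Sp d)) (w : Sp d → ℝ≥0∞) (x : Sp d) : ℝ≥0∞ :=
  ∫⁻ y in {y | edist y x < fillRadius μ w x}, w y ∂μ

/-- The `w μ`-mass of the sphere whose radius is `fillRadius μ w x`. -/
def sphereMass (μ : Measure (Sp d)) (w : Sp d → ℝ≥0∞) (x : Sp d) : ℝ≥0∞ :=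
  ∫⁻ y in {y | edist y x = fillRadius μ w x}, w y ∂μ

/-- The application radius of the site `x`, when the current rejection function is `R`. -/
def applicationRadius (ψ : Measure (Sp d)) (R : Sp d → Sp d → ℝ≥0∞) (x : Sp d) : ℝ≥0∞ :=
  fillRadius ψ (fun ξ => 1 - R x ξ) x

/-- The constant `c ∈ [0, 1]` that makes the new applications of `x` have total mass `1` (see
`lintegral_applicationStep`), and `1` where no such constant is determined. -/
def applicationConst (ψ : Measure (Sp d)) (R : Sp d → Sp d → ℝ≥0∞) (x : Sp d) : ℝ≥0∞ :=
  if applicationRadius ψ R x = ∞ ∨ sphereMass ψ (fun ξ => 1 - R x ξ) x = 0 then 1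
  else 1 - (1 - innerMass ψ (fun ξ => 1 - R x ξ) x) / sphereMass ψ (fun ξ => 1 - R x ξ) x

/-- Step (i) of a stage: the application function obtained from the rejection function `R`. -/
def applicationStep (ψ : Measure (Sp d)) (R : Sp d → Sp d → ℝ≥0∞) (x ξ : Sp d) : ℝ≥0∞ :=
  if edist ξ x < applicationRadius ψ R x then 1
  else if edist ξ x = applicationRadius ψ R x then
    applicationConst ψ R x * R x ξ + (1 - applicationConst ψ R x)
  else 0

/-- The rejection radius of the center `ξ`, when the current application function is `A`. -/
def rejectionRadius (φ : Measure (Sp d)) (A : Sp d → Sp d → ℝ≥0∞) (ξ : Sp d) : ℝ≥0∞ :=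
  fillRadius φ (fun x => A x ξ) ξ

/-- The constant `c' ∈ [0, 1]` that makes the applications kept by `ξ` have total mass `1` (see
`lintegral_rejectionStep`), and `0` where no such constant is determined. -/
def rejectionConst (φ : Measure (Sp d)) (A : Sp d → Sp d → ℝ≥0∞) (ξ : Sp d) : ℝ≥0∞ :=
  if rejectionRadius φ A ξ = ∞ ∨ sphereMass φ (fun x => A x ξ) ξ = 0 then 0
  else 1 - (1 - innerMass φ (fun x => A x ξ) ξ) / sphereMass φ (fun x => A x ξ) ξ

/-- Step (ii) of a stage: the rejection function obtained from the application function `A`. -/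
def rejectionStep (φ : Measure (Sp d)) (A : Sp d → Sp d → ℝ≥0∞) (x ξ : Sp d) : ℝ≥0∞ :=
  if edist x ξ < rejectionRadius φ A ξ then 0
  else if edist x ξ = rejectionRadius φ A ξ then rejectionConst φ A ξ * A x ξ
  else A x ξ

/-- The rejection function `R_n` after `n` stages. -/
def rejectionFn (φ ψ : Measure (Sp d)) : ℕ → Sp d → Sp d → ℝ≥0∞
  | 0 => fun _ _ => 0
  | n + 1 => rejectionStep φ (applicationStep ψ (rejectionFn φ ψ n))

/-- `applicationFn φ ψ n` is the application function `A_{n+1}` of stage `n + 1`. -/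
def applicationFn (φ ψ : Measure (Sp d)) (n : ℕ) : Sp d → Sp d → ℝ≥0∞ :=
  applicationStep ψ (rejectionFn φ ψ n)

/-- The final application function, the pointwise limit of the `A_n`. -/
def finalApplication (φ ψ : Measure (Sp d)) (x ξ : Sp d) : ℝ≥0∞ :=
  limUnder atTop (fun n => applicationFn φ ψ n x ξ)

/-- The final rejection function, the pointwise limit of the `R_n`. -/
def finalRejection (φ ψ : Measure (Sp d)) (x ξ : Sp d) : ℝ≥0∞ :=
  limUnder atTop (fun n => rejectionFn φ ψ n x ξ)

/-- The site-optimal density `f_s = A - R`. -/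
def siteOptimalDensity (φ ψ : Measure (Sp d)) (x ξ : Sp d) : ℝ≥0∞ :=
  finalApplication φ ψ x ξ - finalRejection φ ψ x ξ

/-! ### The constants and the limits exist

The constants in the two steps do satisfy their defining equations, and the sequences
`A_n`, `R_n` are monotone, so that the limits above exist. -/

lemma measurableSet_inner (x : Sp d) (a : ℝ≥0∞) : MeasurableSet {y | edist y x < a} :=
  measurableSet_lt (by fun_prop) measurable_const

lemma measurableSet_sphere (x : Sp d) (a : ℝ≥0∞) : MeasurableSet {y | edist y x = a} :=
  measurableSet_eq_fun (by fun_prop) measurable_const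

lemma innerMass_le_one (μ : Measure (Sp d)) (w : Sp d → ℝ≥0∞) (x : Sp d) :
    innerMass μ w x ≤ 1 := by
  unfold innerMass
  rcases eq_or_ne (fillRadius μ w x) 0 with h0 | h0
  · simp [h0]
  obtain ⟨u, hu, hlt, hlim⟩ := exists_seq_strictMono_tendsto' (pos_iff_ne_zero.2 h0)
  have hset : {y | edist y x < fillRadius μ w x} = ⋃ n, {y | edist y x ≤ u n} := by
    ext y
    simp only [mem_ofPred_eq, mem_iUnion]
    constructor
    · intro hy
      obtain ⟨n, hn⟩ := (hlim.eventually (lt_mem_nhds hy)).exists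
      exact ⟨n, hn.le⟩
    · rintro ⟨n, hn⟩
      exact hn.trans_lt (hlt n).2
  have hm : ∀ n, MeasurableSet {y | edist y x ≤ u n} := fun n =>
    measurableSet_le (by fun_prop) measurable_const
  rw [hset, ← withDensity_apply w (MeasurableSet.iUnion hm),
    (Monotone.directed_le (f := fun n => {y | edist y x ≤ u n}) (fun m n hmn y hy =>
      le_trans (show edist y x ≤ u m from hy) (hu.monotone hmn))).measure_iUnion]
  refine iSup_le fun n => ?_
  rw [withDensity_apply w (hm n)]
  obtain ⟨a, ha⟩ := lt_iSup_iff.1 (hlt n).2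
  obtain ⟨h1, h2⟩ := lt_iSup_iff.1 ha
  refine le_trans (lintegral_mono_set fun y hy => ?_) h1
  have : edist y x ≤ a := le_trans (show edist y x ≤ u n from hy) h2.le
  rw [edist_nndist] at this
  exact_mod_cast this

lemma one_le_innerMass_add (μ : Measure (Sp d)) [IsLocallyFiniteMeasure μ] (w : Sp d → ℝ≥0∞)
    (hw : ∀ y, w y ≤ 1) (x : Sp d) (hr : fillRadius μ w x ≠ ∞) :
    1 ≤ innerMass μ w x + sphereMass μ w x := by
  have hadd : innerMass μ w x + sphereMass μ w x
      = μ.withDensity w {y | edist y x ≤ fillRadius μ w x} := by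
    unfold innerMass sphereMass
    rw [← withDensity_apply w (measurableSet_inner _ _),
      ← withDensity_apply w (measurableSet_sphere _ _), ← measure_union _ (measurableSet_sphere _ _)]
    · congr 1; ext y; simp [le_iff_lt_or_eq]
    · rw [Set.disjoint_left]
      intro y hy hy2
      exact (ne_of_lt hy) hy2
  rw [hadd]
  obtain ⟨b, hb⟩ : ∃ b : ℝ≥0, (b : ℝ≥0∞) = fillRadius μ w x := ⟨_, ENNReal.coe_toNNReal hr⟩
  obtain ⟨u, hu, hlt, hlim⟩ := exists_seq_strictAnti_tendsto b
  have hset : {y | edist y x ≤ fillRadius μ w x} = ⋂ n, Metric.closedBall x (u n : ℝ) := by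
    ext y
    rw [← hb]
    simp only [mem_ofPred_eq, mem_iInter, Metric.mem_closedBall, edist_nndist]
    constructor
    · intro h n
      have h' : nndist y x ≤ b := by exact_mod_cast h
      exact_mod_cast h'.trans (hlt n).le
    · intro h
      have : nndist y x ≤ b := ge_of_tendsto' hlim fun n => by exact_mod_cast h n
      exact_mod_cast this
  rw [hset, Antitone.measure_iInter]
  · refine le_iInf fun n => ?_
    rw [withDensity_apply w measurableSet_closedBall]
    by_contra hcon
    have h1 : ((u n : ℝ≥0) : ℝ≥0∞) ≤ fillRadius μ w x :=
      le_iSup₂_of_le (u n) (not_le.1 hcon).le le_rfl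
    rw [← hb] at h1
    exact absurd (hlt n) (not_lt.2 (by exact_mod_cast h1))
  · intro m n hmn
    exact Metric.closedBall_subset_closedBall (by exact_mod_cast hu.antitone hmn)
  · exact fun n => measurableSet_closedBall.nullMeasurableSet
  · refine ⟨0, ?_⟩
    rw [withDensity_apply w measurableSet_closedBall]
    refine ne_top_of_le_ne_top (measure_closedBall_lt_top (μ := μ) (x := x) (r := (u 0 : ℝ))).ne ?_
    calc ∫⁻ y in Metric.closedBall x (u 0 : ℝ), w y ∂μ
        ≤ ∫⁻ y in Metric.closedBall x (u 0 : ℝ), 1 ∂μ := lintegral_mono fun y => hw y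
      _ = μ (Metric.closedBall x (u 0 : ℝ)) := by simp

lemma applicationConst_le_one (ψ : Measure (Sp d)) (R : Sp d → Sp d → ℝ≥0∞) (x : Sp d) :
    applicationConst ψ R x ≤ 1 := by
  unfold applicationConst; split_ifs
  · exact le_rfl
  · exact tsub_le_self

lemma rejectionConst_le_one (φ : Measure (Sp d)) (A : Sp d → Sp d → ℝ≥0∞) (ξ : Sp d) :
    rejectionConst φ A ξ ≤ 1 := by
  unfold rejectionConst; split_ifs
  · exact zero_le_one
  · exact tsub_le_self

lemma lintegral_split (μ : Measure (Sp d)) (w g : Sp d → ℝ≥0∞) (x : Sp d) (a c : ℝ≥0∞)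
    (hc : c ≠ ∞) (h1 : ∀ y, edist y x < a → g y = w y) (h2 : ∀ y, edist y x = a → g y = c * w y)
    (h3 : ∀ y, a < edist y x → g y = 0) :
    ∫⁻ y, g y ∂μ = (∫⁻ y in {y | edist y x < a}, w y ∂μ)
      + c * ∫⁻ y in {y | edist y x = a}, w y ∂μ := by
  rw [← lintegral_add_compl g (measurableSet_inner x a)]
  congr 1
  · exact setLIntegral_congr_fun (measurableSet_inner x a) h1
  · rw [← lintegral_inter_add_sdiff g _ (measurableSet_sphere x a),
      setLIntegral_congr_fun (g := fun _ => 0) (((measurableSet_inner x a).compl).diff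
        (measurableSet_sphere x a)), lintegral_zero, add_zero,
      ← lintegral_const_mul' c _ hc]
    · have : {y | edist y x < a}ᶜ ∩ {y | edist y x = a} = {y | edist y x = a} := by
        ext y; simp +contextual
      rw [this]
      exact setLIntegral_congr_fun (measurableSet_sphere x a) h2
    · intro y hy
      simp only [Set.mem_sdiff, mem_compl_iff, mem_ofPred_eq, not_lt] at hy
      exact h3 y (lt_of_le_of_ne hy.1 (Ne.symm hy.2))

lemma frac_le_one (μ : Measure (Sp d)) [IsLocallyFiniteMeasure μ] (w : Sp d → ℝ≥0∞)
    (hw : ∀ y, w y ≤ 1) (x : Sp d) (hr : fillRadius μ w x ≠ ∞) :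
    (1 - innerMass μ w x) / sphereMass μ w x ≤ 1 :=
  ENNReal.div_le_of_le_mul (by
    rw [one_mul]; exact tsub_le_iff_left.2 (one_le_innerMass_add μ w hw x hr))

lemma sphereMass_ne_top (μ : Measure (Sp d)) [IsLocallyFiniteMeasure μ] (w : Sp d → ℝ≥0∞)
    (hw : ∀ y, w y ≤ 1) (x : Sp d) (hr : fillRadius μ w x ≠ ∞) : sphereMass μ w x ≠ ∞ := by
  unfold sphereMass
  obtain ⟨b, hb⟩ : ∃ b : ℝ≥0, (b : ℝ≥0∞) = fillRadius μ w x := ⟨_, ENNReal.coe_toNNReal hr⟩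
  refine ne_top_of_le_ne_top (measure_closedBall_lt_top (μ := μ) (x := x) (r := (b : ℝ))).ne ?_
  calc ∫⁻ y in {y | edist y x = fillRadius μ w x}, w y ∂μ
      ≤ ∫⁻ y in {y | edist y x = fillRadius μ w x}, 1 ∂μ := lintegral_mono fun y => hw y
    _ = μ {y | edist y x = fillRadius μ w x} := by simp
    _ ≤ _ := measure_mono fun y hy => by
        have : edist y x = b := by rw [hb]; exact hy
        rw [edist_nndist] at this
        have h' : nndist y x = b := by exact_mod_cast this
        rw [Metric.mem_closedBall, ← h']; rfl

lemma inner_add_frac (μ : Measure (Sp d)) [IsLocallyFiniteMeasure μ] (w : Sp d → ℝ≥0∞)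
    (hw : ∀ y, w y ≤ 1) (x : Sp d) (hr : fillRadius μ w x ≠ ∞) :
    innerMass μ w x + (1 - innerMass μ w x) / sphereMass μ w x * sphereMass μ w x = 1 := by
  have hi := innerMass_le_one μ w x
  have hs := one_le_innerMass_add μ w hw x hr
  rcases eq_or_ne (sphereMass μ w x) 0 with h0 | h0
  · rw [h0, add_zero] at hs; rw [h0, mul_zero, add_zero]; exact le_antisymm hi hs
  · rw [ENNReal.div_mul_cancel h0 (sphereMass_ne_top μ w hw x hr), add_tsub_cancel_of_le hi]

/-- The defining equation of the constant in the application step. -/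
lemma lintegral_applicationStep (ψ : Measure (Sp d)) [IsLocallyFiniteMeasure ψ]
    (R : Sp d → Sp d → ℝ≥0∞) (hR : ∀ x ξ, R x ξ ≤ 1) (x : Sp d)
    (hr : applicationRadius ψ R x ≠ ∞) :
    ∫⁻ ξ, (applicationStep ψ R x ξ - R x ξ) ∂ψ = 1 := by
  have hc1 := applicationConst_le_one ψ R x
  rw [lintegral_split ψ (fun ξ => 1 - R x ξ) _ x (applicationRadius ψ R x)
    (1 - applicationConst ψ R x) (ENNReal.sub_ne_top ENNReal.one_ne_top)]
  · change innerMass ψ (fun ξ => 1 - R x ξ) x + _ * sphereMass ψ (fun ξ => 1 - R x ξ) x = 1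
    have hw : ∀ ξ, 1 - R x ξ ≤ 1 := fun ξ => tsub_le_self
    have key := inner_add_frac ψ _ hw x hr
    by_cases h0 : sphereMass ψ (fun ξ => 1 - R x ξ) x = 0
    · rw [h0, mul_zero] at key ⊢; exact key
    · rw [applicationConst, if_neg (by simp [hr, h0]), ENNReal.sub_sub_cancel ENNReal.one_ne_top
        (frac_le_one ψ _ hw x hr)]
      exact key
  · intro ξ h; simp [applicationStep, h]
  · intro ξ h
    simp only [applicationStep, h, lt_irrefl, if_false, if_true]
    have hR1 := hR x ξ
    lift R x ξ to ℝ≥0 using ne_top_of_le_ne_top ENNReal.one_ne_top hR1 with ρ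
    lift applicationConst ψ R x to ℝ≥0 using ne_top_of_le_ne_top ENNReal.one_ne_top hc1 with c
    norm_cast at hR1 hc1 ⊢
    rw [← NNReal.coe_inj]
    rw [NNReal.coe_sub, NNReal.coe_mul, NNReal.coe_sub hR1, NNReal.coe_sub hc1]
    · push_cast [NNReal.coe_sub hc1]; ring
    · rw [← NNReal.coe_le_coe]; push_cast [NNReal.coe_sub hc1]
      have a1 : (ρ : ℝ) ≤ 1 := by exact_mod_cast hR1
      have a2 : (c : ℝ) ≤ 1 := by exact_mod_cast hc1
      nlinarith
  · intro ξ h; simp [applicationStep, h.not_gt, h.ne']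

/-- The defining equation of the constant in the rejection step. -/
lemma lintegral_rejectionStep (φ : Measure (Sp d)) [IsLocallyFiniteMeasure φ]
    (A : Sp d → Sp d → ℝ≥0∞) (hA : ∀ x ξ, A x ξ ≤ 1) (ξ : Sp d)
    (hr : rejectionRadius φ A ξ ≠ ∞) :
    ∫⁻ x, (A x ξ - rejectionStep φ A x ξ) ∂φ = 1 := by
  rw [lintegral_split φ (fun x => A x ξ) _ ξ (rejectionRadius φ A ξ)
    (1 - rejectionConst φ A ξ) (ENNReal.sub_ne_top ENNReal.one_ne_top)]
  · change innerMass φ (fun x => A x ξ) ξ + _ * sphereMass φ (fun x => A x ξ) ξ = 1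
    have hw : ∀ x, A x ξ ≤ 1 := fun x => hA x ξ
    have key := inner_add_frac φ _ hw ξ hr
    by_cases h0 : sphereMass φ (fun x => A x ξ) ξ = 0
    · rw [h0, mul_zero] at key ⊢; exact key
    · rw [rejectionConst, if_neg (by simp [hr, h0]), ENNReal.sub_sub_cancel ENNReal.one_ne_top
        (frac_le_one φ _ hw ξ hr)]
      exact key
  · intro x h; simp [rejectionStep, h]
  · intro x h
    simp only [rejectionStep, h, lt_irrefl, if_false, if_true]
    rw [ENNReal.sub_mul (fun _ _ => ne_top_of_le_ne_top ENNReal.one_ne_top (hA x ξ)), one_mul]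
  · intro x h; simp [rejectionStep, h.not_gt, h.ne']

lemma fillRadius_anti (μ : Measure (Sp d)) {w w' : Sp d → ℝ≥0∞} (h : ∀ y, w y ≤ w' y)
    (x : Sp d) : fillRadius μ w' x ≤ fillRadius μ w x :=
  iSup₂_le fun a ha => le_iSup₂_of_le a ((lintegral_mono fun y => h y).trans ha) le_rfl

lemma frac_anti (μ : Measure (Sp d)) {w w' : Sp d → ℝ≥0∞} (h : ∀ y, w y ≤ w' y) (x : Sp d)
    (hr : fillRadius μ w' x = fillRadius μ w x) :
    (1 - innerMass μ w' x) / sphereMass μ w' x ≤ (1 - innerMass μ w x) / sphereMass μ w x := by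
  refine ENNReal.div_le_div (tsub_le_tsub_left ?_ _) ?_
  · unfold innerMass; rw [hr]; exact lintegral_mono fun y => h y
  · unfold sphereMass; rw [hr]; exact lintegral_mono fun y => h y

lemma applicationStep_le_one (ψ : Measure (Sp d)) (R : Sp d → Sp d → ℝ≥0∞)
    (hR : ∀ x ξ, R x ξ ≤ 1) (x ξ : Sp d) : applicationStep ψ R x ξ ≤ 1 := by
  unfold applicationStep
  split_ifs
  · exact le_rfl
  · calc _ ≤ applicationConst ψ R x * 1 + (1 - applicationConst ψ R x) := by
          gcongr; exact hR x ξ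
      _ = 1 := by rw [mul_one, add_tsub_cancel_of_le (applicationConst_le_one ψ R x)]
  · exact zero_le_one

lemma rejectionStep_le (φ : Measure (Sp d)) (A : Sp d → Sp d → ℝ≥0∞) (x ξ : Sp d) :
    rejectionStep φ A x ξ ≤ A x ξ := by
  unfold rejectionStep
  split_ifs
  · exact zero_le
  · exact mul_le_of_le_one_left zero_le (rejectionConst_le_one φ A ξ)
  · exact le_rfl

lemma applicationConst_anti (ψ : Measure (Sp d)) [IsLocallyFiniteMeasure ψ]
    {R R' : Sp d → Sp d → ℝ≥0∞} (h : ∀ x ξ, R x ξ ≤ R' x ξ) (x : Sp d)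
    (hr : applicationRadius ψ R x = applicationRadius ψ R' x)
    (hfin : applicationRadius ψ R x ≠ ∞) :
    applicationConst ψ R' x ≤ applicationConst ψ R x := by
  have hw : ∀ y, 1 - R' x y ≤ 1 - R x y := fun y => tsub_le_tsub_left (h x y) _
  by_cases h0 : sphereMass ψ (fun ξ => 1 - R x ξ) x = 0
  · rw [applicationConst.eq_def ψ R, if_pos (Or.inr h0)]
    exact applicationConst_le_one ψ R' x
  · rw [applicationConst.eq_def ψ R, if_neg (by simp [h0, hfin])]
    have hfr := frac_anti ψ hw x hr
    by_cases h0' : sphereMass ψ (fun ξ => 1 - R' x ξ) x = 0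
    · have h1 := one_le_innerMass_add ψ (fun ξ => 1 - R' x ξ) (fun _ => tsub_le_self) x
        (by rw [applicationRadius, applicationRadius] at hr; rw [← hr]; exact hfin)
      rw [h0', add_zero] at h1
      have h2 : innerMass ψ (fun ξ => 1 - R' x ξ) x ≤ innerMass ψ (fun ξ => 1 - R x ξ) x := by
        unfold innerMass; rw [applicationRadius, applicationRadius] at hr; rw [hr]
        exact lintegral_mono fun y => hw y
      rw [tsub_eq_zero_of_le (h1.trans h2), ENNReal.zero_div, tsub_zero]
      exact applicationConst_le_one ψ R' x
    · rw [applicationConst, if_neg (by simp [h0', ← hr, hfin])]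
      exact tsub_le_tsub_left hfr _

lemma applicationStep_mono (ψ : Measure (Sp d)) [IsLocallyFiniteMeasure ψ]
    {R R' : Sp d → Sp d → ℝ≥0∞} (h : ∀ x ξ, R x ξ ≤ R' x ξ) (hR' : ∀ x ξ, R' x ξ ≤ 1)
    (x ξ : Sp d) : applicationStep ψ R x ξ ≤ applicationStep ψ R' x ξ := by
  have hR : ∀ x ξ, R x ξ ≤ 1 := fun x ξ => (h x ξ).trans (hR' x ξ)
  have hle : applicationRadius ψ R x ≤ applicationRadius ψ R' x :=
    fillRadius_anti ψ (fun y => tsub_le_tsub_left (h x y) _) x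
  rcases lt_trichotomy (edist ξ x) (applicationRadius ψ R' x) with h1 | h1 | h1
  · rw [applicationStep.eq_def ψ R', if_pos h1]; exact applicationStep_le_one ψ R hR x ξ
  · rcases hle.lt_or_eq with h2 | h2
    · rw [applicationStep, if_neg (by rw [h1]; exact h2.not_gt), if_neg (by rw [h1]; exact h2.ne')]
      exact zero_le
    · have hfin : applicationRadius ψ R x ≠ ∞ := by rw [h2, ← h1]; exact edist_ne_top _ _
      have hc := applicationConst_anti ψ h x h2 hfin
      have hc1 := applicationConst_le_one ψ R x
      simp only [applicationStep, h1, h2, lt_irrefl, if_false, if_true]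
      calc applicationConst ψ R x * R x ξ + (1 - applicationConst ψ R x)
          ≤ applicationConst ψ R x * R' x ξ + (1 - applicationConst ψ R x) := by
            gcongr; exact h x ξ
        _ = applicationConst ψ R' x * R' x ξ
              + ((applicationConst ψ R x - applicationConst ψ R' x) * R' x ξ
              + (1 - applicationConst ψ R x)) := by
            rw [← add_assoc, ← add_mul, add_tsub_cancel_of_le hc]
        _ ≤ applicationConst ψ R' x * R' x ξ
              + ((applicationConst ψ R x - applicationConst ψ R' x) * 1
              + (1 - applicationConst ψ R x)) := by
            gcongr; exact hR' x ξ
        _ = _ := by rw [mul_one, add_comm (_ - _) (1 - _), tsub_add_tsub_cancel hc1 hc]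
  · have h2 := hle.trans_lt h1
    rw [applicationStep, if_neg h2.not_gt, if_neg h2.ne']; exact zero_le

lemma rejectionConst_mono (φ : Measure (Sp d))
    {A A' : Sp d → Sp d → ℝ≥0∞} (h : ∀ x ξ, A x ξ ≤ A' x ξ) (ξ : Sp d)
    (hr : rejectionRadius φ A' ξ = rejectionRadius φ A ξ) :
    rejectionConst φ A ξ ≤ rejectionConst φ A' ξ := by
  rw [rejectionConst.eq_def φ A]
  split_ifs with h0
  · exact zero_le
  · push Not at h0
    have hs : sphereMass φ (fun x => A x ξ) ξ ≤ sphereMass φ (fun x => A' x ξ) ξ := by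
      unfold sphereMass; rw [rejectionRadius, rejectionRadius] at hr; rw [hr]
      exact lintegral_mono fun y => h y ξ
    have h0' : sphereMass φ (fun x => A' x ξ) ξ ≠ 0 := fun hz =>
      h0.2 (le_antisymm (hs.trans hz.le) zero_le)
    rw [rejectionConst, if_neg (by simp [h0', hr, h0.1])]
    exact tsub_le_tsub_left (frac_anti φ (fun y => h y ξ) ξ hr) _

lemma rejectionStep_mono (φ : Measure (Sp d))
    {A A' : Sp d → Sp d → ℝ≥0∞} (h : ∀ x ξ, A x ξ ≤ A' x ξ) (x ξ : Sp d) :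
    rejectionStep φ A x ξ ≤ rejectionStep φ A' x ξ := by
  have hle : rejectionRadius φ A' ξ ≤ rejectionRadius φ A ξ :=
    fillRadius_anti φ (fun y => h y ξ) ξ
  rcases lt_trichotomy (edist x ξ) (rejectionRadius φ A' ξ) with h1 | h1 | h1
  · rw [rejectionStep, if_pos (h1.trans_le hle)]; exact zero_le
  · rcases hle.lt_or_eq with h2 | h2
    · rw [rejectionStep, if_pos (h1.trans_lt h2)]; exact zero_le
    · simp only [rejectionStep, h1, h2, lt_irrefl, if_false, if_true]
      exact mul_le_mul' (rejectionConst_mono φ h ξ h2) (h x ξ)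
  · rw [rejectionStep.eq_def φ A', if_neg h1.not_gt, if_neg h1.ne']
    exact (rejectionStep_le φ A x ξ).trans (h x ξ)

lemma rejectionFn_le_one (φ ψ : Measure (Sp d)) (n : ℕ) (x ξ : Sp d) :
    rejectionFn φ ψ n x ξ ≤ 1 := by
  induction n generalizing x ξ with
  | zero => exact zero_le
  | succ n ih => exact (rejectionStep_le _ _ _ _).trans (applicationStep_le_one ψ _ ih x ξ)

lemma rejectionFn_le_succ (φ ψ : Measure (Sp d)) [IsLocallyFiniteMeasure ψ]
    (n : ℕ) (x ξ : Sp d) : rejectionFn φ ψ n x ξ ≤ rejectionFn φ ψ (n + 1) x ξ := by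
  induction n generalizing x ξ with
  | zero => exact zero_le
  | succ n ih =>
    exact rejectionStep_mono φ
      (fun x ξ => applicationStep_mono ψ ih (rejectionFn_le_one φ ψ (n + 1)) x ξ) x ξ

lemma rejectionFn_monotone (φ ψ : Measure (Sp d)) [IsLocallyFiniteMeasure ψ] (x ξ : Sp d) :
    Monotone fun n => rejectionFn φ ψ n x ξ :=
  monotone_nat_of_le_succ fun n => rejectionFn_le_succ φ ψ n x ξ

lemma applicationFn_monotone (φ ψ : Measure (Sp d)) [IsLocallyFiniteMeasure ψ] (x ξ : Sp d) :
    Monotone fun n => applicationFn φ ψ n x ξ :=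
  monotone_nat_of_le_succ fun n => applicationStep_mono ψ (rejectionFn_le_succ φ ψ n)
    (rejectionFn_le_one φ ψ (n + 1)) x ξ

/-- The limit of the rejection functions exists. -/
lemma tendsto_finalRejection (φ ψ : Measure (Sp d)) [IsLocallyFiniteMeasure ψ] (x ξ : Sp d) :
    Tendsto (fun n => rejectionFn φ ψ n x ξ) atTop (𝓝 (finalRejection φ ψ x ξ)) :=
  tendsto_nhds_limUnder ⟨_, tendsto_atTop_iSup (rejectionFn_monotone φ ψ x ξ)⟩

/-- The limit of the application functions exists. -/
lemma tendsto_finalApplication (φ ψ : Measure (Sp d)) [IsLocallyFiniteMeasure ψ] (x ξ : Sp d) :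
    Tendsto (fun n => applicationFn φ ψ n x ξ) atTop (𝓝 (finalApplication φ ψ x ξ)) :=
  tendsto_nhds_limUnder ⟨_, tendsto_atTop_iSup (applicationFn_monotone φ ψ x ξ)⟩

/-! ### Densities and transport kernels -/

/-- Sub-balancing densities for `φ` and `ψ`. -/
structure IsSubBalancing (φ ψ : Measure (Sp d)) (f : Sp d → Sp d → ℝ≥0∞) : Prop where
  measurable : Measurable (Function.uncurry f)
  site_le : ∀ x, ∫⁻ ξ, f x ξ ∂ψ ≤ 1
  center_le : ∀ ξ, ∫⁻ x, f x ξ ∂φ ≤ 1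

/-- Balancing densities for `φ` and `ψ`. -/
structure IsBalancing (φ ψ : Measure (Sp d)) (f : Sp d → Sp d → ℝ≥0∞) : Prop
    extends IsSubBalancing φ ψ f where
  site_eq : ∀ᵐ x ∂φ, ∫⁻ ξ, f x ξ ∂ψ = 1
  center_eq : ∀ᵐ ξ ∂ψ, ∫⁻ x, f x ξ ∂φ = 1

/-- Constrained densities for `φ` and `ψ`. -/
structure IsConstrained (φ ψ : Measure (Sp d)) (f : Sp d → Sp d → ℝ≥0∞) : Prop
    extends IsSubBalancing φ ψ f where
  le_one : ∀ x ξ, f x ξ ≤ 1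

/-- The kernel `T(x, B) = ∫_B f(x, ξ) ψ(dξ)` of a density. -/
def densityKernel (ψ : Measure (Sp d)) (f : Sp d → Sp d → ℝ≥0∞) (x : Sp d) : Measure (Sp d) :=
  ψ.withDensity (f x)

/-- `T` is a `(φ, ψ)`-balancing transport kernel: a measurable map into the locally finite
measures, Markovian for `φ`-almost every point, transporting `φ` to `ψ`. -/
structure IsBalancingTransportKernel (φ ψ : Measure (Sp d)) (T : Sp d → Measure (Sp d)) :
    Prop where
  measurable : Measurable T
  locallyFinite : ∀ x, IsLocallyFiniteMeasure (T x)
  markov : ∀ᵐ x ∂φ, T x univ = 1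
  balancing : ∀ B : Set (Sp d), MeasurableSet B → ∫⁻ x, T x B ∂φ = ψ B

/-! ### Flows and random measures -/

/-- A measurable flow indexed by `ℝ^d`. -/
structure MeasurableFlow (d : ℕ) (Ω : Type*) [MeasurableSpace Ω] where
  toFun : Sp d → Ω → Ω
  measurable' : Measurable fun p : Ω × Sp d => toFun p.2 p.1
  zero' : toFun 0 = id
  add' : ∀ s t, toFun s ∘ toFun t = toFun (s + t)

instance {Ω : Type*} [MeasurableSpace Ω] :
    CoeFun (MeasurableFlow d Ω) (fun _ => Sp d → Ω → Ω) := ⟨MeasurableFlow.toFun⟩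

/-- The shift of measures, `(θ_s μ)(B) = μ(B + s)`. -/
def shiftMeasure (s : Sp d) (μ : Measure (Sp d)) : Measure (Sp d) :=
  μ.map (fun x => x - s)

/-- `(ℙ, Φ)` is an ergodic (stationary) random measure on `ℝ^d`. -/
structure IsErgodicRandomMeasure {Ω : Type*} [MeasurableSpace Ω] (θ : MeasurableFlow d Ω)
    (ℙ : Measure Ω) (Φ : Ω → Measure (Sp d)) : Prop where
  isProbability : IsProbabilityMeasure ℙ
  measurable : Measurable Φ
  locallyFinite : ∀ ω, IsLocallyFiniteMeasure (Φ ω)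
  flowAdapted : ∀ s ω, Φ (θ s ω) = shiftMeasure s (Φ ω)
  stationary : ∀ s, ℙ.map (θ s) = ℙ
  ergodic : ∀ S : Set Ω, MeasurableSet S → (∀ s, θ s ⁻¹' S = S) → ℙ S = 0 ∨ ℙ S = 1

/-- `lam` is the intensity of `(ℙ, Φ)`. -/
def HasIntensity {Ω : Type*} [MeasurableSpace Ω] (ℙ : Measure Ω) (Φ : Ω → Measure (Sp d))
    (lam : ℝ≥0∞) : Prop :=
  ∀ B : Set (Sp d), MeasurableSet B → ∫⁻ ω, Φ ω B ∂ℙ = lam * volume B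

/-- A measurable flow-adapted family of functions on `ℝ^d × ℝ^d`. -/
structure IsFlowAdaptedDensity {Ω : Type*} [MeasurableSpace Ω] (θ : MeasurableFlow d Ω)
    (F : Ω → Sp d → Sp d → ℝ≥0∞) : Prop where
  measurable : Measurable fun p : Ω × Sp d × Sp d => F p.1 p.2.1 p.2.2
  flowAdapted : ∀ s ω x ξ, F (θ s ω) x ξ = F ω (x + s) (ξ + s)

/-- A measurable flow-adapted family of kernels, `T_{θ_s ω}(x, B) = T_ω(x + s, B + s)`. -/
structure IsFlowAdaptedKernel {Ω : Type*} [MeasurableSpace Ω] (θ : MeasurableFlow d Ω)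
    (T : Ω → Sp d → Measure (Sp d)) : Prop where
  measurable : Measurable fun p : Ω × Sp d => T p.1 p.2
  flowAdapted : ∀ s ω x, T (θ s ω) x = shiftMeasure s (T ω (x + s))

end GaleShapley

end

/-! Fix one realization and write `f = A - R` for the limits `A`, `R` of the application and
rejection functions. In every stage the new applications of a site have mass at most `1`, and
exactly `1` if its application radius is finite; the applications kept by a center behave likewise.
Fatou's lemma gives both marginal bounds for `f`. A site of mass less than `1` must have unbounded
application radii, since otherwise dominated convergence on a ball would give it mass `1`; hence `A
= 1` along it (`finalApplication_eq_one_of_lintegral_lt_one`). A center of mass less than `1` always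
has infinite rejection radius, hence `R = 0` along it
(`finalRejection_eq_zero_of_lintegral_lt_one`). So `f = 1` at every pair of an unexhausted site and
an unsated center, and one unexhausted site forces the total deficit of the centers to be at most
`1` (`lintegral_center_deficit_le_one`).

Probability enters in three ways. By mass transport (`IsFlowAdaptedDensity.massTransport`) and the
equality of the finite intensities, sites and centers have the same expected total deficit
(`deficitMeasure_univ_eq`). By ergodicity, either almost surely the sites have no deficit, or almost
surely some site is unexhausted. In the second case the expected deficit of the centers is a
translation invariant measure of mass at most `1` on a space of positive dimension, so it is zero
(`eq_zero_of_map_add_eq_self`). In both cases both deficits vanish, which is the balancing property.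

Measurability and flow-adaptedness pass through each stage of the algorithm and then to the limit.
-/

noncomputable section

namespace GaleShapley

open ProbabilityTheory

variable {d : ℕ}

/-! ### Kernels with locally finite values -/

/-- A kernel all of whose values are finite measures is s-finite. -/
lemma isSFiniteKernel_of_isFiniteMeasure {α β : Type*} [MeasurableSpace α] [MeasurableSpace β]
    (κ : Kernel α β) (h : ∀ a, κ a univ ≠ ∞) : IsSFiniteKernel κ := by
  classical
  -- The parameter space is sliced by the integer part of the total mass, because a finite kernel
  -- needs a bound uniform in the parameter; on slice `m` the bound is `m + 1`.
  have hm : ∀ m : ℕ, MeasurableSet {a | ⌊(κ a univ).toNNReal⌋₊ = m} := fun m =>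
    (Nat.measurable_floor.comp (κ.measurable_coe MeasurableSet.univ).ennreal_toNNReal)
      (measurableSet_singleton m)
  have hκ : κ = Kernel.sum fun m : ℕ => Kernel.piecewise (hm m) κ 0 := by
    ext a s hs
    rw [Kernel.sum_apply' _ _ hs, tsum_eq_single ⌊(κ a univ).toNNReal⌋₊]
    · simp [Kernel.piecewise_apply]
    · intro m hm'
      simp [Kernel.piecewise_apply, hm'.symm]
  rw [hκ]
  have : ∀ m, IsFiniteKernel (Kernel.piecewise (hm m) κ 0) := by
    intro m
    refine ⟨⟨(m + 1 : ℝ≥0), ENNReal.coe_lt_top, fun a => ?_⟩⟩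
    rw [Kernel.piecewise_apply]
    split_ifs with ha
    · have h1 : (κ a univ).toNNReal < m + 1 := by
        have := Nat.lt_floor_add_one (κ a univ).toNNReal
        rwa [show ⌊(κ a univ).toNNReal⌋₊ = m from ha] at this
      rw [← ENNReal.coe_toNNReal (h a)]
      exact_mod_cast h1.le
    · simp
  infer_instance

/-- A kernel all of whose values are locally finite measures is s-finite. -/
lemma isSFiniteKernel_of_isLocallyFiniteMeasure {α : Type*} [MeasurableSpace α]
    (κ : Kernel α (Sp d)) (h : ∀ a, IsLocallyFiniteMeasure (κ a)) : IsSFiniteKernel κ := by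
  -- Restriction to these bounded shells makes every value finite, though not uniformly in `a`; the
  -- preceding lemma supplies the rest.
  let B : ℕ → Set (Sp d) := fun n => {y | ⌊‖y‖⌋₊ = n}
  have hB : ∀ n, MeasurableSet (B n) := fun n =>
    (Nat.measurable_floor.comp measurable_norm) (measurableSet_singleton n)
  have hκ : κ = Kernel.sum fun n : ℕ => Kernel.restrict κ (hB n) := by
    ext a s hs
    rw [Kernel.sum_apply' _ _ hs]
    simp_rw [Kernel.restrict_apply' _ (hB _) _ hs]
    rw [← measure_iUnion _ fun n => hs.inter (hB n)]
    · congr 1; ext y; simp [B]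
    · intro m n hmn
      rw [Function.onFun, Set.disjoint_left]
      rintro y ⟨-, hy⟩ ⟨-, hy'⟩
      exact hmn (hy.symm.trans hy')
  rw [hκ]
  suffices ∀ n, IsSFiniteKernel (Kernel.restrict κ (hB n)) from inferInstance
  refine fun n => isSFiniteKernel_of_isFiniteMeasure _ fun a => ?_
  rw [Kernel.restrict_apply, Measure.restrict_apply_univ]
  have := h a
  refine ne_top_of_le_ne_top
    (measure_closedBall_lt_top (μ := κ a) (x := 0) (r := (n : ℝ) + 1)).ne
    (measure_mono fun y hy => ?_)
  rw [mem_closedBall_zero_iff, ← show ⌊‖y‖⌋₊ = n from hy]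
  exact (Nat.lt_floor_add_one _).le

/-! ### Joint measurability of the algorithm -/

section Measurability

variable {α : Type*} [MeasurableSpace α]

/-- The domain must be allowed to vary with the parameter, since balls and spheres are cut at
parameter-dependent centers and radii. An indicator moves it into the integrand. -/
lemma measurable_setLIntegral_kernel (κ : Kernel α (Sp d)) [IsSFiniteKernel κ]
    {w : α → Sp d → ℝ≥0∞} (hw : Measurable (Function.uncurry w)) {s : α → Set (Sp d)}
    (hs : MeasurableSet {p : α × Sp d | p.2 ∈ s p.1}) :
    Measurable fun a => ∫⁻ y in s a, w a y ∂(κ a) := by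
  have hsa : ∀ a, MeasurableSet (s a) := fun a => measurable_prodMk_left hs
  simp_rw [← lintegral_indicator (hsa _)]
  refine Measurable.lintegral_kernel_prod_right (κ := κ) ?_
  have : (Function.uncurry fun a b => (s a).indicator (w a) b)
      = {p : α × Sp d | p.2 ∈ s p.1}.indicator (Function.uncurry w) := by
    ext ⟨a, b⟩; simp [Set.indicator, Function.uncurry]
  rw [this]
  exact hw.indicator hs

/-- The admissible radii form an initial segment, so rational ones already exhaust the supremum, and
a countable supremum preserves measurability. An inadmissible radius contributes `0`, which does not
affect the supremum. -/
lemma fillRadius_eq_iSup_rat (μ : Measure (Sp d)) (w : Sp d → ℝ≥0∞) (x : Sp d) :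
    fillRadius μ w x = ⨆ q : ℚ≥0,
      {t : ℝ≥0∞ | t ≤ 1}.indicator (fun _ => ((q : ℝ≥0) : ℝ≥0∞))
        (∫⁻ y in {y | edist y x ≤ ((q : ℝ≥0) : ℝ≥0∞)}, w y ∂μ) := by
  have hball : ∀ a : ℝ≥0, {y | edist y x ≤ (a : ℝ≥0∞)} = Metric.closedBall x (a : ℝ) := by
    intro a; ext y
    rw [mem_ofPred_eq, edist_nndist, Metric.mem_closedBall, ← coe_nndist]
    norm_cast
  simp_rw [hball]
  apply le_antisymm
  · refine iSup₂_le fun a ha => le_of_forall_lt fun c hc => ?_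
    obtain ⟨q, hq0, hq1, hq2⟩ := ENNReal.lt_iff_exists_rat_btwn.1 hc
    lift q to ℚ≥0 using hq0
    have hcast : ((Real.toNNReal ((q : ℚ) : ℝ) : ℝ≥0) : ℝ≥0∞) = ((q : ℝ≥0) : ℝ≥0∞) := by
      congr 1
      ext
      rw [Real.coe_toNNReal _ (by positivity)]
      norm_cast
    rw [hcast] at hq1 hq2
    refine hq1.trans_le (le_iSup_of_le q ?_)
    rw [Set.indicator_of_mem]
    refine le_trans (lintegral_mono_set (Metric.closedBall_subset_closedBall ?_)) ha
    exact_mod_cast hq2.le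
  · refine iSup_le fun q => ?_
    by_cases h : ∫⁻ y in Metric.closedBall x ((q : ℝ≥0) : ℝ), w y ∂μ ≤ 1
    · rw [Set.indicator_of_mem (by exact h)]
      exact le_iSup₂_of_le (q : ℝ≥0) h le_rfl
    · rw [Set.indicator_of_notMem (by exact h)]
      exact zero_le

lemma measurable_fillRadius (κ : Kernel α (Sp d)) [IsSFiniteKernel κ]
    {w : α → Sp d → ℝ≥0∞} (hw : Measurable (Function.uncurry w)) {c : α → Sp d}
    (hc : Measurable c) : Measurable fun a => fillRadius (κ a) (w a) (c a) := by
  simp_rw [fillRadius_eq_iSup_rat]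
  refine Measurable.iSup fun q => ?_
  refine (Measurable.indicator measurable_const measurableSet_Iic).comp
    (measurable_setLIntegral_kernel κ hw ?_)
  exact measurableSet_le (measurable_snd.edist (hc.comp measurable_fst)) measurable_const

lemma measurable_innerMass (κ : Kernel α (Sp d)) [IsSFiniteKernel κ]
    {w : α → Sp d → ℝ≥0∞} (hw : Measurable (Function.uncurry w)) {c : α → Sp d}
    (hc : Measurable c) : Measurable fun a => innerMass (κ a) (w a) (c a) := by
  refine measurable_setLIntegral_kernel κ hw ?_
  exact measurableSet_lt (measurable_snd.edist (hc.comp measurable_fst))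
    ((measurable_fillRadius κ hw hc).comp measurable_fst)

lemma measurable_sphereMass (κ : Kernel α (Sp d)) [IsSFiniteKernel κ]
    {w : α → Sp d → ℝ≥0∞} (hw : Measurable (Function.uncurry w)) {c : α → Sp d}
    (hc : Measurable c) : Measurable fun a => sphereMass (κ a) (w a) (c a) := by
  refine measurable_setLIntegral_kernel κ hw ?_
  exact measurableSet_eq_fun (measurable_snd.edist (hc.comp measurable_fst))
    ((measurable_fillRadius κ hw hc).comp measurable_fst)

/-! ### Measurability of one stage, and of the limit -/

variable (κ η : Kernel α (Sp d))

lemma measurable_applicationRadius [IsSFiniteKernel η] {R : α → Sp d → Sp d → ℝ≥0∞}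
    (hR : Measurable fun p : α × Sp d × Sp d => R p.1 p.2.1 p.2.2) :
    Measurable fun p : α × Sp d => applicationRadius (η p.1) (R p.1) p.2 := by
  have hw : Measurable (Function.uncurry fun (p : α × Sp d) ξ => 1 - R p.1 p.2 ξ) :=
    measurable_const.sub (hR.comp (by fun_prop :
      Measurable fun q : (α × Sp d) × Sp d => (q.1.1, q.1.2, q.2)))
  -- The point `x` joins the parameter; `Kernel.prodMkRight` is the kernel that ignores it.
  exact measurable_fillRadius (Kernel.prodMkRight (Sp d) η) hw measurable_snd

lemma measurable_applicationConst [IsSFiniteKernel η] {R : α → Sp d → Sp d → ℝ≥0∞}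
    (hR : Measurable fun p : α × Sp d × Sp d => R p.1 p.2.1 p.2.2) :
    Measurable fun p : α × Sp d => applicationConst (η p.1) (R p.1) p.2 := by
  have hw : Measurable (Function.uncurry fun (p : α × Sp d) ξ => 1 - R p.1 p.2 ξ) :=
    measurable_const.sub (hR.comp (by fun_prop :
      Measurable fun q : (α × Sp d) × Sp d => (q.1.1, q.1.2, q.2)))
  have hs := measurable_sphereMass (Kernel.prodMkRight (Sp d) η) hw measurable_snd
  have hi := measurable_innerMass (Kernel.prodMkRight (Sp d) η) hw measurable_snd
  refine Measurable.ite (.union ?_ ?_) measurable_const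
    (measurable_const.sub ((measurable_const.sub hi).div hs))
  · exact measurable_applicationRadius η hR (measurableSet_singleton ∞)
  · exact hs (measurableSet_singleton 0)

lemma measurable_applicationStep [IsSFiniteKernel η] {R : α → Sp d → Sp d → ℝ≥0∞}
    (hR : Measurable fun p : α × Sp d × Sp d => R p.1 p.2.1 p.2.2) :
    Measurable fun p : α × Sp d × Sp d => applicationStep (η p.1) (R p.1) p.2.1 p.2.2 := by
  have hπ : Measurable fun p : α × Sp d × Sp d => (p.1, p.2.1) := by fun_prop
  have ha := (measurable_applicationRadius η hR).comp hπ
  have hc := (measurable_applicationConst η hR).comp hπ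
  have he : Measurable fun p : α × Sp d × Sp d => edist p.2.2 p.2.1 := by fun_prop
  exact Measurable.ite (measurableSet_lt he ha) measurable_const
    (Measurable.ite (measurableSet_eq_fun he ha)
      ((hc.mul hR).add (measurable_const.sub hc)) measurable_const)

lemma measurable_rejectionRadius [IsSFiniteKernel κ] {A : α → Sp d → Sp d → ℝ≥0∞}
    (hA : Measurable fun p : α × Sp d × Sp d => A p.1 p.2.1 p.2.2) :
    Measurable fun p : α × Sp d => rejectionRadius (κ p.1) (A p.1) p.2 :=
  measurable_fillRadius (Kernel.prodMkRight (Sp d) κ) (w := fun p x => A p.1 x p.2)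
    (hA.comp (by fun_prop : Measurable fun q : (α × Sp d) × Sp d => (q.1.1, q.2, q.1.2)))
    measurable_snd

lemma measurable_rejectionConst [IsSFiniteKernel κ] {A : α → Sp d → Sp d → ℝ≥0∞}
    (hA : Measurable fun p : α × Sp d × Sp d => A p.1 p.2.1 p.2.2) :
    Measurable fun p : α × Sp d => rejectionConst (κ p.1) (A p.1) p.2 := by
  have hw : Measurable (Function.uncurry fun (p : α × Sp d) x => A p.1 x p.2) :=
    hA.comp (by fun_prop : Measurable fun q : (α × Sp d) × Sp d => (q.1.1, q.2, q.1.2))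
  have hs := measurable_sphereMass (Kernel.prodMkRight (Sp d) κ) hw measurable_snd
  have hi := measurable_innerMass (Kernel.prodMkRight (Sp d) κ) hw measurable_snd
  refine Measurable.ite (.union ?_ ?_) measurable_const
    (measurable_const.sub ((measurable_const.sub hi).div hs))
  · exact measurable_rejectionRadius κ hA (measurableSet_singleton ∞)
  · exact hs (measurableSet_singleton 0)

lemma measurable_rejectionStep [IsSFiniteKernel κ] {A : α → Sp d → Sp d → ℝ≥0∞}
    (hA : Measurable fun p : α × Sp d × Sp d => A p.1 p.2.1 p.2.2) :
    Measurable fun p : α × Sp d × Sp d => rejectionStep (κ p.1) (A p.1) p.2.1 p.2.2 := by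
  have hπ : Measurable fun p : α × Sp d × Sp d => (p.1, p.2.2) := by fun_prop
  have hr := (measurable_rejectionRadius κ hA).comp hπ
  have hc := (measurable_rejectionConst κ hA).comp hπ
  have he : Measurable fun p : α × Sp d × Sp d => edist p.2.1 p.2.2 := by fun_prop
  exact Measurable.ite (measurableSet_lt he hr) measurable_const
    (Measurable.ite (measurableSet_eq_fun he hr) (hc.mul hA) hA)

variable [IsSFiniteKernel κ] [IsSFiniteKernel η]

lemma measurable_rejectionFn_kernel (n : ℕ) :
    Measurable fun p : α × Sp d × Sp d => rejectionFn (κ p.1) (η p.1) n p.2.1 p.2.2 := by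
  induction n with
  | zero => exact measurable_const
  | succ n ih =>
    exact
      measurable_rejectionStep κ
        (A := fun a => applicationStep (η a) (rejectionFn (κ a) (η a) n))
        (measurable_applicationStep η (R := fun a => rejectionFn (κ a) (η a) n) ih)

lemma measurable_applicationFn_kernel (n : ℕ) :
    Measurable fun p : α × Sp d × Sp d => applicationFn (κ p.1) (η p.1) n p.2.1 p.2.2 :=
  measurable_applicationStep η (R := fun a => rejectionFn (κ a) (η a) n)
    (measurable_rejectionFn_kernel κ η n)

lemma measurable_siteOptimalDensity_kernel [∀ a, IsLocallyFiniteMeasure (η a)] :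
    Measurable fun p : α × Sp d × Sp d => siteOptimalDensity (κ p.1) (η p.1) p.2.1 p.2.2 :=
  (measurable_of_tendsto_metrizable (measurable_applicationFn_kernel κ η)
    (tendsto_pi_nhds.2 fun _ => tendsto_finalApplication _ _ _ _)).sub
  (measurable_of_tendsto_metrizable (measurable_rejectionFn_kernel κ η)
    (tendsto_pi_nhds.2 fun _ => tendsto_finalRejection _ _ _ _))

end Measurability

/-! ### Two fixed measures, as constant kernels over a one-point space -/

section Deterministic

variable (φ ψ : Measure (Sp d)) [IsLocallyFiniteMeasure φ] [IsLocallyFiniteMeasure ψ]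

lemma measurable_rejectionFn (n : ℕ) : Measurable (Function.uncurry (rejectionFn φ ψ n)) := by
  have h := measurable_rejectionFn_kernel (Kernel.const Unit φ) (Kernel.const Unit ψ) n
  simp only [Kernel.const_apply] at h
  have h' := h.comp (measurable_prodMk_left (x := ()))
  simp only [Function.comp_def] at h'
  simpa only [Function.uncurry_def] using h'

lemma measurable_applicationFn (n : ℕ) :
    Measurable (Function.uncurry (applicationFn φ ψ n)) := by
  have h := measurable_applicationFn_kernel (Kernel.const Unit φ) (Kernel.const Unit ψ) n
  simp only [Kernel.const_apply] at h
  have h' := h.comp (measurable_prodMk_left (x := ()))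
  simp only [Function.comp_def] at h'
  simpa only [Function.uncurry_def] using h'

lemma measurable_siteOptimalDensity :
    Measurable (Function.uncurry (siteOptimalDensity φ ψ)) := by
  have : ∀ a : Unit, IsLocallyFiniteMeasure (Kernel.const Unit ψ a) := fun _ => ‹_›
  have h := measurable_siteOptimalDensity_kernel (Kernel.const Unit φ) (Kernel.const Unit ψ)
  simp only [Kernel.const_apply] at h
  have h' := h.comp (measurable_prodMk_left (x := ()))
  simp only [Function.comp_def] at h'
  simpa only [Function.uncurry_def] using h'

end Deterministic

/-! ### Equivariance under shifts -/

/-- For an embedding the change of variables holds for arbitrary integrands, so the equivariance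
lemmas require no measurability of `R` or `A`. -/
lemma measurableEmbedding_sub_right (s : Sp d) : MeasurableEmbedding fun x : Sp d => x - s :=
  (MeasurableEquiv.subRight s).measurableEmbedding

lemma lintegral_shiftMeasure (s : Sp d) (μ : Measure (Sp d)) (g : Sp d → ℝ≥0∞) :
    ∫⁻ y, g y ∂(shiftMeasure s μ) = ∫⁻ y, g (y - s) ∂μ :=
  (measurableEmbedding_sub_right s).lintegral_map g

lemma setLIntegral_shiftMeasure (s : Sp d) (μ : Measure (Sp d)) (g : Sp d → ℝ≥0∞)
    (B : Set (Sp d)) :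
    ∫⁻ y in B, g y ∂(shiftMeasure s μ) = ∫⁻ y in {y | y - s ∈ B}, g (y - s) ∂μ := by
  rw [shiftMeasure, (measurableEmbedding_sub_right s).restrict_map,
    (measurableEmbedding_sub_right s).lintegral_map]
  rfl

lemma edist_sub_right_eq (y s x : Sp d) : edist (y - s) x = edist y (x + s) := by
  rw [← edist_add_right (y - s) x s, sub_add_cancel]

lemma fillRadius_shiftMeasure (s : Sp d) (μ : Measure (Sp d)) (w : Sp d → ℝ≥0∞) (x : Sp d) :
    fillRadius (shiftMeasure s μ) (fun y => w (y + s)) x = fillRadius μ w (x + s) := by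
  unfold fillRadius
  refine iSup_congr fun a => ?_
  have : {y | y - s ∈ Metric.closedBall x (a : ℝ)} = Metric.closedBall (x + s) (a : ℝ) := by
    ext y
    simp only [mem_ofPred_eq, Metric.mem_closedBall]
    rw [← dist_add_right (y - s) x s, sub_add_cancel]
  rw [setLIntegral_shiftMeasure, this]
  simp only [sub_add_cancel]

lemma innerMass_shiftMeasure (s : Sp d) (μ : Measure (Sp d)) (w : Sp d → ℝ≥0∞) (x : Sp d) :
    innerMass (shiftMeasure s μ) (fun y => w (y + s)) x = innerMass μ w (x + s) := by
  simp only [innerMass, fillRadius_shiftMeasure, setLIntegral_shiftMeasure, sub_add_cancel,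
    mem_ofPred_eq, edist_sub_right_eq]

lemma sphereMass_shiftMeasure (s : Sp d) (μ : Measure (Sp d)) (w : Sp d → ℝ≥0∞) (x : Sp d) :
    sphereMass (shiftMeasure s μ) (fun y => w (y + s)) x = sphereMass μ w (x + s) := by
  simp only [sphereMass, fillRadius_shiftMeasure, setLIntegral_shiftMeasure, sub_add_cancel,
    mem_ofPred_eq, edist_sub_right_eq]

lemma applicationStep_shiftMeasure (s : Sp d) (ψ : Measure (Sp d)) (R : Sp d → Sp d → ℝ≥0∞)
    (x ξ : Sp d) :
    applicationStep (shiftMeasure s ψ) (fun x ξ => R (x + s) (ξ + s)) x ξ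
      = applicationStep ψ R (x + s) (ξ + s) := by
  have hr := fillRadius_shiftMeasure s ψ (fun ξ => 1 - R (x + s) ξ) x
  have hi := innerMass_shiftMeasure s ψ (fun ξ => 1 - R (x + s) ξ) x
  have hs := sphereMass_shiftMeasure s ψ (fun ξ => 1 - R (x + s) ξ) x
  simp only [applicationStep, applicationConst, applicationRadius, hr, hi, hs, edist_add_right]
  congr

lemma rejectionStep_shiftMeasure (s : Sp d) (φ : Measure (Sp d)) (A : Sp d → Sp d → ℝ≥0∞)
    (x ξ : Sp d) :
    rejectionStep (shiftMeasure s φ) (fun x ξ => A (x + s) (ξ + s)) x ξ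
      = rejectionStep φ A (x + s) (ξ + s) := by
  have hr := fillRadius_shiftMeasure s φ (fun x => A x (ξ + s)) ξ
  have hi := innerMass_shiftMeasure s φ (fun x => A x (ξ + s)) ξ
  have hs := sphereMass_shiftMeasure s φ (fun x => A x (ξ + s)) ξ
  simp only [rejectionStep, rejectionConst, rejectionRadius, hr, hi, hs, edist_add_right]
  congr

lemma rejectionFn_shiftMeasure (s : Sp d) (φ ψ : Measure (Sp d)) (n : ℕ) :
    rejectionFn (shiftMeasure s φ) (shiftMeasure s ψ) n
      = fun x ξ => rejectionFn φ ψ n (x + s) (ξ + s) := by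
  induction n with
  | zero => rfl
  | succ n ih =>
    ext x ξ
    rw [rejectionFn, ih, rejectionFn, ← rejectionStep_shiftMeasure]
    simp_rw [← applicationStep_shiftMeasure]

lemma applicationFn_shiftMeasure (s : Sp d) (φ ψ : Measure (Sp d)) (n : ℕ) (x ξ : Sp d) :
    applicationFn (shiftMeasure s φ) (shiftMeasure s ψ) n x ξ
      = applicationFn φ ψ n (x + s) (ξ + s) := by
  rw [applicationFn, applicationFn, rejectionFn_shiftMeasure, applicationStep_shiftMeasure]

/-- Both sides are built from limits of the same sequences, so no convergence is needed. -/
lemma siteOptimalDensity_shiftMeasure (s : Sp d) (φ ψ : Measure (Sp d)) (x ξ : Sp d) :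
    siteOptimalDensity (shiftMeasure s φ) (shiftMeasure s ψ) x ξ
      = siteOptimalDensity φ ψ (x + s) (ξ + s) := by
  simp only [siteOptimalDensity, finalApplication, finalRejection, applicationFn_shiftMeasure,
    rejectionFn_shiftMeasure]

lemma densityKernel_shiftMeasure (s : Sp d) (ψ : Measure (Sp d)) {f g : Sp d → Sp d → ℝ≥0∞}
    (h : ∀ x ξ, g x ξ = f (x + s) (ξ + s)) (x : Sp d) :
    densityKernel (shiftMeasure s ψ) g x = shiftMeasure s (densityKernel ψ f (x + s)) := by
  ext B hB
  have hm : Measurable fun y : Sp d => y - s := (measurableEmbedding_sub_right s).measurable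
  rw [densityKernel, withDensity_apply _ hB, setLIntegral_shiftMeasure, shiftMeasure,
    Measure.map_apply hm hB, densityKernel, withDensity_apply _ (hm hB)]
  simp only [h, sub_add_cancel]
  rfl

/-! ### The site-optimal density of two locally finite measures -/

lemma applicationStep_eq_one_of_radius_eq_top {ψ : Measure (Sp d)} {R : Sp d → Sp d → ℝ≥0∞}
    {x : Sp d} (h : applicationRadius ψ R x = ∞) (ξ : Sp d) : applicationStep ψ R x ξ = 1 := by
  rw [applicationStep, if_pos (by rw [h]; exact edist_lt_top _ _)]

lemma rejectionStep_eq_zero_of_radius_eq_top {φ : Measure (Sp d)} {A : Sp d → Sp d → ℝ≥0∞}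
    {ξ : Sp d} (h : rejectionRadius φ A ξ = ∞) (x : Sp d) : rejectionStep φ A x ξ = 0 := by
  rw [rejectionStep, if_pos (by rw [h]; exact edist_lt_top _ _)]

lemma innerMass_of_fillRadius_eq_top {μ : Measure (Sp d)} {w : Sp d → ℝ≥0∞} {x : Sp d}
    (h : fillRadius μ w x = ∞) : innerMass μ w x = ∫⁻ y, w y ∂μ := by
  have : {y : Sp d | edist y x < fillRadius μ w x} = univ := by
    ext y; simp [h, edist_lt_top]
  rw [innerMass, this, Measure.restrict_univ]

/-- When the radius is infinite, the whole space is the open ball of that radius, and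
`innerMass_le_one` applies to it. -/
lemma lintegral_applicationStep_sub_le (ψ : Measure (Sp d)) [IsLocallyFiniteMeasure ψ]
    {R : Sp d → Sp d → ℝ≥0∞} (hR : ∀ x ξ, R x ξ ≤ 1) (x : Sp d) :
    ∫⁻ ξ, (applicationStep ψ R x ξ - R x ξ) ∂ψ ≤ 1 := by
  by_cases hr : applicationRadius ψ R x = ∞
  · simp_rw [applicationStep_eq_one_of_radius_eq_top hr]
    rw [← innerMass_of_fillRadius_eq_top hr]
    exact innerMass_le_one _ _ _
  · exact (lintegral_applicationStep ψ R hR x hr).le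

lemma lintegral_sub_rejectionStep_le (φ : Measure (Sp d)) [IsLocallyFiniteMeasure φ]
    {A : Sp d → Sp d → ℝ≥0∞} (hA : ∀ x ξ, A x ξ ≤ 1) (ξ : Sp d) :
    ∫⁻ x, (A x ξ - rejectionStep φ A x ξ) ∂φ ≤ 1 := by
  by_cases hr : rejectionRadius φ A ξ = ∞
  · simp_rw [rejectionStep_eq_zero_of_radius_eq_top hr, tsub_zero]
    rw [← innerMass_of_fillRadius_eq_top hr]
    exact innerMass_le_one _ _ _
  · exact (lintegral_rejectionStep φ A hA ξ hr).le

/-! ### Marginals of the limiting density -/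

section

variable (φ ψ : Measure (Sp d))

lemma applicationFn_le_one (n : ℕ) (x ξ : Sp d) : applicationFn φ ψ n x ξ ≤ 1 :=
  applicationStep_le_one ψ _ (rejectionFn_le_one φ ψ n) x ξ

variable [IsLocallyFiniteMeasure ψ]

lemma finalApplication_le_one (x ξ : Sp d) : finalApplication φ ψ x ξ ≤ 1 :=
  le_of_tendsto' (tendsto_finalApplication φ ψ x ξ) fun n => applicationFn_le_one φ ψ n x ξ

lemma siteOptimalDensity_le_one (x ξ : Sp d) : siteOptimalDensity φ ψ x ξ ≤ 1 :=
  tsub_le_self.trans (finalApplication_le_one φ ψ x ξ)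

/-- Since `applicationFn φ ψ n` is `A_{n+1}`, this sequence is `A_{n+1} - R_n`, the new
applications, whose mass is controlled along sites. The next lemma treats `A_{n+1} - R_{n+1}`, the
kept applications, whose mass is controlled along centers. Both have the same limit. -/
lemma tendsto_applicationFn_sub_rejectionFn (x ξ : Sp d) :
    Tendsto (fun n => applicationFn φ ψ n x ξ - rejectionFn φ ψ n x ξ) atTop
      (𝓝 (siteOptimalDensity φ ψ x ξ)) :=
  ENNReal.Tendsto.sub (tendsto_finalApplication φ ψ x ξ) (tendsto_finalRejection φ ψ x ξ)
    (Or.inl (ne_top_of_le_ne_top ENNReal.one_ne_top (finalApplication_le_one φ ψ x ξ)))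

lemma tendsto_applicationFn_sub_rejectionFn_succ (x ξ : Sp d) :
    Tendsto (fun n => applicationFn φ ψ n x ξ - rejectionFn φ ψ (n + 1) x ξ) atTop
      (𝓝 (siteOptimalDensity φ ψ x ξ)) :=
  ENNReal.Tendsto.sub (tendsto_finalApplication φ ψ x ξ)
    ((tendsto_finalRejection φ ψ x ξ).comp (tendsto_add_atTop_nat 1))
    (Or.inl (ne_top_of_le_ne_top ENNReal.one_ne_top (finalApplication_le_one φ ψ x ξ)))

variable [IsLocallyFiniteMeasure φ]

lemma measurable_applicationFn_sub_rejectionFn (m n : ℕ) :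
    Measurable (Function.uncurry fun x ξ => applicationFn φ ψ m x ξ - rejectionFn φ ψ n x ξ) :=
  (measurable_applicationFn φ ψ m).sub (measurable_rejectionFn φ ψ n)

/-- By Fatou's lemma. Mass may escape to infinity along the stages, so only an inequality survives.
-/
lemma lintegral_siteOptimalDensity_site_le (x : Sp d) :
    ∫⁻ ξ, siteOptimalDensity φ ψ x ξ ∂ψ ≤ 1 := by
  calc ∫⁻ ξ, siteOptimalDensity φ ψ x ξ ∂ψ
      = ∫⁻ ξ, liminf (fun n => applicationFn φ ψ n x ξ - rejectionFn φ ψ n x ξ) atTop ∂ψ :=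
        lintegral_congr fun ξ => (tendsto_applicationFn_sub_rejectionFn φ ψ x ξ).liminf_eq.symm
    _ ≤ liminf (fun n => ∫⁻ ξ, (applicationFn φ ψ n x ξ - rejectionFn φ ψ n x ξ) ∂ψ) atTop :=
        lintegral_liminf_le fun n =>
          (measurable_applicationFn_sub_rejectionFn φ ψ n n).of_uncurry_left
    _ ≤ 1 := liminf_le_of_le (by isBoundedDefault) fun b hb => by
        obtain ⟨n, hn⟩ := hb.exists
        exact hn.trans (lintegral_applicationStep_sub_le ψ (rejectionFn_le_one φ ψ n) x)

lemma lintegral_siteOptimalDensity_center_le (ξ : Sp d) :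
    ∫⁻ x, siteOptimalDensity φ ψ x ξ ∂φ ≤ 1 := by
  calc ∫⁻ x, siteOptimalDensity φ ψ x ξ ∂φ
      = ∫⁻ x, liminf (fun n => applicationFn φ ψ n x ξ - rejectionFn φ ψ (n + 1) x ξ) atTop ∂φ :=
        lintegral_congr fun x =>
          (tendsto_applicationFn_sub_rejectionFn_succ φ ψ x ξ).liminf_eq.symm
    _ ≤ liminf (fun n => ∫⁻ x, (applicationFn φ ψ n x ξ - rejectionFn φ ψ (n + 1) x ξ) ∂φ) atTop :=
        lintegral_liminf_le fun n =>
          (measurable_applicationFn_sub_rejectionFn φ ψ n (n + 1)).of_uncurry_right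
    _ ≤ 1 := liminf_le_of_le (by isBoundedDefault) fun b hb => by
        obtain ⟨n, hn⟩ := hb.exists
        exact hn.trans (lintegral_sub_rejectionStep_le φ (applicationFn_le_one φ ψ n) ξ)

lemma isConstrained_siteOptimalDensity : IsConstrained φ ψ (siteOptimalDensity φ ψ) where
  measurable := measurable_siteOptimalDensity φ ψ
  site_le := lintegral_siteOptimalDensity_site_le φ ψ
  center_le := lintegral_siteOptimalDensity_center_le φ ψ
  le_one := siteOptimalDensity_le_one φ ψ

/-- If functions bounded by `1` and vanishing off a fixed ball converge pointwise and have integral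
`1`, the limit has integral `1`. -/
lemma lintegral_eq_one_of_tendsto (μ : Measure (Sp d)) [IsLocallyFiniteMeasure μ]
    {g : ℕ → Sp d → ℝ≥0∞} {f : Sp d → ℝ≥0∞} (hg : ∀ n, Measurable (g n)) (c : Sp d) {b : ℝ≥0∞}
    (hb : b ≠ ∞) (hg1 : ∀ n y, g n y ≤ 1) (hg0 : ∀ n y, b < edist y c → g n y = 0)
    (hlim : ∀ y, Tendsto (fun n => g n y) atTop (𝓝 (f y))) (hint : ∀ n, ∫⁻ y, g n y ∂μ = 1) :
    ∫⁻ y, f y ∂μ = 1 := by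
  have hbound : ∀ n, g n ≤ (Metric.closedBall c b.toReal).indicator fun _ => 1 := by
    intro n y
    by_cases hy : y ∈ Metric.closedBall c b.toReal
    · rw [Set.indicator_of_mem hy]; exact hg1 n y
    · rw [hg0 n y]
      · exact zero_le
      · rw [Metric.mem_closedBall, not_le] at hy
        rw [edist_dist]
        exact (ENNReal.lt_ofReal_iff_toReal_lt hb).2 hy
  have h := tendsto_lintegral_of_dominated_convergence (μ := μ) _ hg
    (fun n => Eventually.of_forall (hbound n)) (by
      rw [lintegral_indicator measurableSet_closedBall, setLIntegral_one]
      exact (measure_closedBall_lt_top (μ := μ)).ne) (Eventually.of_forall hlim)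
  simp_rw [hint] at h
  exact tendsto_nhds_unique h tendsto_const_nhds

/-- A site which is not exhausted eventually applies to every center. -/
lemma finalApplication_eq_one_of_lintegral_lt_one {x : Sp d}
    (hx : ∫⁻ ξ, siteOptimalDensity φ ψ x ξ ∂ψ < 1) (ξ : Sp d) : finalApplication φ ψ x ξ = 1 := by
  -- If the radii were bounded, the new applications of `x` would live in one ball and have mass
  -- exactly `1` in every stage, and so would their limit.
  have hsup : ⨆ n, applicationRadius ψ (rejectionFn φ ψ n) x = ∞ := by
    by_contra hne
    have hle := fun n => le_iSup (fun n => applicationRadius ψ (rejectionFn φ ψ n) x) n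
    refine hx.ne (lintegral_eq_one_of_tendsto ψ (fun n =>
      (measurable_applicationFn_sub_rejectionFn φ ψ n n).of_uncurry_left) x hne
      (fun n ξ => tsub_le_self.trans (applicationFn_le_one φ ψ n x ξ)) (fun n ξ h => ?_)
      (tendsto_applicationFn_sub_rejectionFn φ ψ x) fun n =>
        lintegral_applicationStep ψ _ (rejectionFn_le_one φ ψ n) x
          (ne_top_of_le_ne_top hne (hle n)))
    have h' := (hle n).trans_lt h
    rw [applicationFn, applicationStep, if_neg h'.not_gt, if_neg h'.ne', zero_tsub]
  obtain ⟨n, hn⟩ := lt_iSup_iff.1 (hsup ▸ edist_lt_top ξ x)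
  refine le_antisymm (finalApplication_le_one φ ψ x ξ) ?_
  have := (applicationFn_monotone φ ψ x ξ).ge_of_tendsto (tendsto_finalApplication φ ψ x ξ) n
  rwa [applicationFn, applicationStep, if_pos hn] at this

/-- A center which is not sated never rejects. -/
lemma finalRejection_eq_zero_of_lintegral_lt_one {ξ : Sp d}
    (hξ : ∫⁻ x, siteOptimalDensity φ ψ x ξ ∂φ < 1) (x : Sp d) : finalRejection φ ψ x ξ = 0 := by
  have hanti : Antitone fun n => rejectionRadius φ (applicationFn φ ψ n) ξ := fun m n hmn =>
    fillRadius_anti φ (fun x => applicationFn_monotone φ ψ x ξ hmn) ξ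
  -- Rejection radii decrease with the stage. Once one is finite, all later ones are bounded by it,
  -- so the kept applications have mass `1` from stage `n` on; the shift by `n` discards the earlier
  -- stages.
  have htop : ∀ n, rejectionRadius φ (applicationFn φ ψ n) ξ = ∞ := by
    intro n
    by_contra hne
    have hle : ∀ k, rejectionRadius φ (applicationFn φ ψ (k + n)) ξ
        ≤ rejectionRadius φ (applicationFn φ ψ n) ξ := fun k => hanti (Nat.le_add_left n k)
    refine hξ.ne (lintegral_eq_one_of_tendsto φ (fun k =>
      (measurable_applicationFn_sub_rejectionFn φ ψ (k + n) (k + n + 1)).of_uncurry_right) ξ hne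
      (fun k x => tsub_le_self.trans (applicationFn_le_one φ ψ (k + n) x ξ)) (fun k x h => ?_)
      (fun x => (tendsto_applicationFn_sub_rejectionFn_succ φ ψ x ξ).comp
        (tendsto_add_atTop_nat n)) fun k =>
        lintegral_rejectionStep φ _ (applicationFn_le_one φ ψ (k + n)) ξ
          (ne_top_of_le_ne_top hne (hle k)))
    have h' := (hle k).trans_lt h
    change _ - rejectionStep φ (applicationFn φ ψ (k + n)) x ξ = 0
    rw [rejectionStep, if_neg h'.not_gt, if_neg h'.ne', tsub_self]
  refine tendsto_nhds_unique (tendsto_finalRejection φ ψ x ξ)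
    (tendsto_const_nhds.congr fun n => ?_)
  cases n with
  | zero => rfl
  | succ n => exact (rejectionStep_eq_zero_of_radius_eq_top (htop n) x).symm

/-- If some site is not exhausted, then the unused capacity of the centers is at most `1`. -/
lemma lintegral_center_deficit_le_one {x : Sp d}
    (hx : ∫⁻ ξ, siteOptimalDensity φ ψ x ξ ∂ψ < 1) :
    ∫⁻ ξ, (1 - ∫⁻ y, siteOptimalDensity φ ψ y ξ ∂φ) ∂ψ ≤ 1 := by
  -- The deficit of `ξ` is bounded pointwise by the density at `(x, ξ)`: if `ξ` is unsated the
  -- density there is `1 - 0`, and otherwise the deficit is `0`.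
  refine (lintegral_mono fun ξ => ?_).trans hx.le
  by_cases hξ : ∫⁻ y, siteOptimalDensity φ ψ y ξ ∂φ < 1
  · rw [siteOptimalDensity, finalApplication_eq_one_of_lintegral_lt_one φ ψ hx,
      finalRejection_eq_zero_of_lintegral_lt_one φ ψ hξ, tsub_zero]
    exact tsub_le_self
  · rw [tsub_eq_zero_of_le (not_lt.1 hξ)]
    exact zero_le

lemma isBalancingTransportKernel_of_isBalancing {f : Sp d → Sp d → ℝ≥0∞}
    (hf : IsBalancing φ ψ f) : IsBalancingTransportKernel φ ψ (densityKernel ψ f) where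
  measurable := by
    refine Measure.measurable_of_measurable_coe _ fun B hB => ?_
    simp_rw [densityKernel, withDensity_apply _ hB]
    exact hf.measurable.lintegral_prod_right'
  locallyFinite x := by
    have : IsFiniteMeasure (densityKernel ψ f x) := ⟨by
      rw [densityKernel, withDensity_apply _ MeasurableSet.univ, Measure.restrict_univ]
      exact (hf.site_le x).trans_lt ENNReal.one_lt_top⟩
    infer_instance
  markov := by
    filter_upwards [hf.site_eq] with x hx
    rw [densityKernel, withDensity_apply _ MeasurableSet.univ, Measure.restrict_univ, hx]
  balancing B hB := by
    simp_rw [densityKernel, withDensity_apply _ hB]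
    rw [lintegral_lintegral_swap hf.measurable.aemeasurable,
      lintegral_congr_ae (ae_restrict_of_ae hf.center_eq), setLIntegral_one]

end

/-! ### Weighted intensity measures and mass transport -/

section WeightedIntensity

variable {Ω β : Type*} [MeasurableSpace Ω] [MeasurableSpace β]

/-- The measure `B ↦ 𝔼 ∫_B g(ω, y) κ_ω(dy)`. -/
def weightedIntensity (P : Measure Ω) (κ : Kernel Ω β) (g : Ω × β → ℝ≥0∞) : Measure β :=
  ((P ⊗ₘ κ).withDensity g).map Prod.snd

instance (P : Measure Ω) (κ : Kernel Ω β) (g : Ω × β → ℝ≥0∞) :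
    SFinite (weightedIntensity P κ g) := by
  unfold weightedIntensity; infer_instance

variable (P : Measure Ω) [SFinite P] (κ : Kernel Ω β) [IsSFiniteKernel κ] {g : Ω × β → ℝ≥0∞}

lemma lintegral_weightedIntensity (hg : Measurable g) {h : β → ℝ≥0∞} (hh : Measurable h) :
    ∫⁻ y, h y ∂(weightedIntensity P κ g) = ∫⁻ ω, ∫⁻ y, g (ω, y) * h y ∂(κ ω) ∂P := by
  have hh' : Measurable fun p : Ω × β => h p.2 := hh.comp measurable_snd
  rw [weightedIntensity, lintegral_map hh measurable_snd,
    lintegral_withDensity_eq_lintegral_mul _ hg hh', Measure.lintegral_compProd (hg.mul hh')]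
  rfl

lemma weightedIntensity_apply (hg : Measurable g) {B : Set β} (hB : MeasurableSet B) :
    weightedIntensity P κ g B = ∫⁻ ω, ∫⁻ y in B, g (ω, y) ∂(κ ω) ∂P := by
  rw [← lintegral_indicator_one hB,
    lintegral_weightedIntensity P κ hg (measurable_one.indicator hB)]
  refine lintegral_congr fun ω => ?_
  rw [← lintegral_indicator hB]
  refine lintegral_congr fun y => ?_
  by_cases hy : y ∈ B <;> simp [hy]

/-- The weighted intensity measure inherits the invariance of `P`, if kernel and weight are
adapted. -/
lemma map_weightedIntensity_eq_self (hg : Measurable g) {T : Ω → Ω} (hT : MeasurePreserving T P P)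
    {τ : β → β} (hτ : Measurable τ) (hκ : ∀ ω, κ ω = (κ (T ω)).map τ)
    (hgT : ∀ ω y, g (T ω, y) = g (ω, τ y)) :
    (weightedIntensity P κ g).map τ = weightedIntensity P κ g := by
  refine Measure.ext_of_lintegral _ fun h hh => ?_
  rw [lintegral_map hh hτ, lintegral_weightedIntensity P κ hg hh,
    lintegral_weightedIntensity P κ hg (h := fun y => h (τ y)) (hh.comp hτ)]
  have hm : Measurable fun ω => ∫⁻ y, g (ω, y) * h (τ y) ∂(κ ω) :=
    Measurable.lintegral_kernel_prod_right (κ := κ)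
      (hg.mul ((hh.comp hτ).comp measurable_snd))
  -- Invariance of `P` replaces `ω` by `T ω` on one side. On the other side `κ ω` is the image of `κ
  -- (T ω)` under `τ`, and adaptedness of `g` identifies the inner integrals.
  rw [← hT.lintegral_comp hm]
  refine lintegral_congr fun ω => ?_
  have hm' : Measurable fun y => g (ω, y) * h y := (hg.comp measurable_prodMk_left).mul hh
  rw [hκ ω, lintegral_map hm' hτ]
  simp_rw [hgT]

end WeightedIntensity

/-- The mass transport principle: the marginals of a measure on `ℝ^d × ℝ^d` which is invariant
under diagonal shifts coincide. -/
lemma measure_prod_univ_eq_of_map_add_eq_self (M : Measure (Sp d × Sp d)) [SFinite M]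
    (hM : ∀ s : Sp d, M.map (fun p => (p.1 + s, p.2 + s)) = M) {Q : Set (Sp d)}
    (hQ : MeasurableSet Q) (hQ0 : volume Q ≠ 0) (hQt : volume Q ≠ ∞) :
    M (Q ×ˢ univ) = M (univ ×ˢ Q) := by
  set i : Sp d → ℝ≥0∞ := Q.indicator 1 with hi
  have him : Measurable i := measurable_one.indicator hQ
  have hvol : ∫⁻ y, i y = volume Q := lintegral_indicator_one hQ
  have h1 : ∫⁻ p, i p.1 ∂M = M (Q ×ˢ univ) := by
    rw [← lintegral_indicator_one (hQ.prod MeasurableSet.univ)]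
    refine lintegral_congr fun p => ?_
    by_cases hp : p.1 ∈ Q <;> simp [hi, hp, Set.indicator]
  have h2 : ∫⁻ p, i p.2 ∂M = M (univ ×ˢ Q) := by
    rw [← lintegral_indicator_one (MeasurableSet.univ.prod hQ)]
    refine lintegral_congr fun p => ?_
    by_cases hp : p.2 ∈ Q <;> simp [hi, hp, Set.indicator]
  -- Averaging the second point over all shifts produces the factor `volume Q`, wherever that point
  -- lies; diagonal invariance then moves the shift to the first point. The two masses may be
  -- infinite: only `volume Q` is cancelled.
  have key : (∫⁻ p, i p.1 ∂M) * volume Q = (∫⁻ p, i p.2 ∂M) * volume Q := by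
    calc (∫⁻ p, i p.1 ∂M) * volume Q
        = ∫⁻ p, ∫⁻ s, i p.1 * i (p.2 + s) ∂volume ∂M := by
          rw [← lintegral_mul_const _ (by fun_prop)]
          refine lintegral_congr fun p => ?_
          rw [lintegral_const_mul _ (by fun_prop), lintegral_add_left_eq_self i p.2, hvol]
      _ = ∫⁻ s, ∫⁻ p, i p.1 * i (p.2 + s) ∂M ∂volume :=
          lintegral_lintegral_swap (by
            simp only [Function.uncurry_def]; fun_prop)
      _ = ∫⁻ s, ∫⁻ p, i (p.1 - s) * i p.2 ∂M ∂volume := by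
          refine lintegral_congr fun s => ?_
          conv_rhs => rw [← hM s]
          rw [lintegral_map (by fun_prop) (by fun_prop)]
          simp
      _ = ∫⁻ p, ∫⁻ s, i (p.1 - s) * i p.2 ∂volume ∂M :=
          lintegral_lintegral_swap (by
            simp only [Function.uncurry_def]; fun_prop)
      _ = (∫⁻ p, i p.2 ∂M) * volume Q := by
          rw [← lintegral_mul_const _ (by fun_prop)]
          refine lintegral_congr fun p => ?_
          rw [lintegral_mul_const _ (by fun_prop), lintegral_sub_left_eq_self i p.1, hvol, mul_comm]
  rw [← h1, ← h2]
  exact (ENNReal.mul_left_inj hQ0 hQt).1 key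

/-- A finite translation invariant measure on `ℝ^d`, `d > 0`, vanishes. -/
lemma eq_zero_of_map_add_eq_self (hd : 0 < d) (m : Measure (Sp d)) [IsFiniteMeasure m]
    (hm : ∀ s : Sp d, m.map (fun x => x + s) = m) : m = 0 := by
  have : Nonempty (Fin d) := ⟨⟨0, hd⟩⟩
  have : Nontrivial (Sp d) := inferInstance
  have : m.IsAddLeftInvariant := ⟨fun s => by simpa only [add_comm s] using hm s⟩
  have hv : (volume : Measure (Sp d)) univ = ∞ := by
    have : NoncompactSpace (Sp d) := NormedSpace.noncompactSpace ℝ (Sp d)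
    exact measure_univ_of_isAddLeftInvariant _
  have h := Measure.isAddLeftInvariant_eq_smul m (volume : Measure (Sp d))
  -- By uniqueness of Haar measure `m` is a multiple of Lebesgue measure, whose total mass is
  -- infinite as `d > 0`; finiteness forces the factor `0`.
  have hc : Measure.addHaarScalarFactor m (volume : Measure (Sp d)) = 0 := by
    by_contra hne
    refine measure_ne_top m univ ?_
    rw [h, Measure.smul_apply, hv, ENNReal.smul_top, if_neg hne]
  rw [h, hc, zero_smul]

/-! ### Flow-adapted random measures -/

section Flow

variable {Ω : Type*} [MeasurableSpace Ω] {θ : MeasurableFlow d Ω} {P : Measure Ω}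
  {Φ Ψ : Ω → Measure (Sp d)}

lemma IsErgodicRandomMeasure.measurePreserving (hΦ : IsErgodicRandomMeasure θ P Φ) (s : Sp d) :
    MeasurePreserving (θ s) P P :=
  ⟨θ.measurable'.comp (measurable_id.prodMk measurable_const), hΦ.stationary s⟩

/-- Flow-adaptedness solved for `Φ ω`, the form that `map_weightedIntensity_eq_self` takes with `τ`
the translation by `s`. -/
lemma IsErgodicRandomMeasure.eq_map (hΦ : IsErgodicRandomMeasure θ P Φ) (s : Sp d) (ω : Ω) :
    Φ ω = (Φ (θ s ω)).map fun x => x + s := by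
  rw [hΦ.flowAdapted, shiftMeasure, Measure.map_map (by fun_prop) (by fun_prop)]
  have : ((fun x : Sp d => x + s) ∘ fun x => x - s) = id := by ext1 x; simp
  rw [this, Measure.map_id]

/-- An ergodic random measure as a kernel. -/
def IsErgodicRandomMeasure.kernel (hΦ : IsErgodicRandomMeasure θ P Φ) : Kernel Ω (Sp d) :=
  ⟨Φ, hΦ.measurable⟩

instance (hΦ : IsErgodicRandomMeasure θ P Φ) : IsSFiniteKernel hΦ.kernel :=
  isSFiniteKernel_of_isLocallyFiniteMeasure _ hΦ.locallyFinite

instance (hΦ : IsErgodicRandomMeasure θ P Φ) (ω : Ω) : IsLocallyFiniteMeasure (hΦ.kernel ω) :=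
  hΦ.locallyFinite ω

/-- The site-optimal density of two ergodic random measures is measurable and flow-adapted. -/
lemma isFlowAdaptedDensity_siteOptimalDensity (hΦ : IsErgodicRandomMeasure θ P Φ)
    (hΨ : IsErgodicRandomMeasure θ P Ψ) :
    IsFlowAdaptedDensity θ fun ω => siteOptimalDensity (Φ ω) (Ψ ω) where
  measurable := measurable_siteOptimalDensity_kernel hΦ.kernel hΨ.kernel
  flowAdapted s ω x ξ := by
    rw [hΦ.flowAdapted, hΨ.flowAdapted, siteOptimalDensity_shiftMeasure]

lemma isFlowAdaptedKernel_densityKernel (hΨ : IsErgodicRandomMeasure θ P Ψ)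
    {F : Ω → Sp d → Sp d → ℝ≥0∞} (hF : IsFlowAdaptedDensity θ F) :
    IsFlowAdaptedKernel θ fun ω => densityKernel (Ψ ω) (F ω) where
  measurable := by
    refine Measure.measurable_of_measurable_coe _ fun B hB => ?_
    simp_rw [densityKernel, withDensity_apply _ hB]
    refine Measurable.setLIntegral_kernel_prod_right (κ := Kernel.prodMkRight (Sp d) hΨ.kernel)
      (f := fun p ξ => F p.1 p.2 ξ) ?_ hB
    exact hF.measurable.comp (by fun_prop :
      Measurable fun q : (Ω × Sp d) × Sp d => (q.1.1, q.1.2, q.2))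
  flowAdapted s ω x := by
    rw [hΨ.flowAdapted]
    exact densityKernel_shiftMeasure s (Ψ ω) (hF.flowAdapted s ω) x

variable {F : Ω → Sp d → Sp d → ℝ≥0∞}

lemma IsFlowAdaptedDensity.measurable_site (hF : IsFlowAdaptedDensity θ F)
    (hΨ : IsErgodicRandomMeasure θ P Ψ) :
    Measurable fun p : Ω × Sp d => ∫⁻ ξ, F p.1 p.2 ξ ∂(Ψ p.1) :=
  Measurable.lintegral_kernel_prod_right (κ := Kernel.prodMkRight (Sp d) hΨ.kernel)
    (f := fun p ξ => F p.1 p.2 ξ) (hF.measurable.comp (by fun_prop :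
      Measurable fun q : (Ω × Sp d) × Sp d => (q.1.1, q.1.2, q.2)))

/-- The density with the roles of sites and centers exchanged. -/
lemma IsFlowAdaptedDensity.swap (hF : IsFlowAdaptedDensity θ F) :
    IsFlowAdaptedDensity θ fun ω ξ x => F ω x ξ where
  measurable := hF.measurable.comp (by fun_prop :
    Measurable fun q : Ω × Sp d × Sp d => (q.1, q.2.2, q.2.1))
  flowAdapted s ω ξ x := hF.flowAdapted s ω x ξ

lemma IsFlowAdaptedDensity.lintegral_site_flow (hF : IsFlowAdaptedDensity θ F)
    (hΨ : IsErgodicRandomMeasure θ P Ψ) (s : Sp d) (ω : Ω) (x : Sp d) :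
    ∫⁻ ξ, F (θ s ω) x ξ ∂(Ψ (θ s ω)) = ∫⁻ ξ, F ω (x + s) ξ ∂(Ψ ω) := by
  rw [hΨ.flowAdapted, lintegral_shiftMeasure]
  simp_rw [hF.flowAdapted, sub_add_cancel]

/-- Mass transport: on average, a set of sites sends as much as the same set of centers
receives. -/
lemma IsFlowAdaptedDensity.massTransport (hF : IsFlowAdaptedDensity θ F)
    (hΦ : IsErgodicRandomMeasure θ P Φ) (hΨ : IsErgodicRandomMeasure θ P Ψ) {Q : Set (Sp d)}
    (hQ : MeasurableSet Q) (hQ0 : volume Q ≠ 0) (hQt : volume Q ≠ ∞) :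
    ∫⁻ ω, ∫⁻ x in Q, ∫⁻ ξ, F ω x ξ ∂(Ψ ω) ∂(Φ ω) ∂P
      = ∫⁻ ω, ∫⁻ ξ in Q, ∫⁻ x, F ω x ξ ∂(Φ ω) ∂(Ψ ω) ∂P := by
  have := hΦ.isProbability
  have hΦl := hΦ.locallyFinite
  have hΨl := hΨ.locallyFinite
  set g : Ω × Sp d × Sp d → ℝ≥0∞ := fun p => F p.1 p.2.1 p.2.2
  have hg : Measurable g := hF.measurable
  have hprod : ∀ ω, (hΦ.kernel ×ₖ hΨ.kernel) ω = (Φ ω).prod (Ψ ω) := fun ω =>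
    Kernel.prod_apply _ _ _
  -- The measure `𝔼 F(x, ξ) Φ(dx) Ψ(dξ)` is invariant under diagonal shifts; its marginals on `Q`
  -- are the expected masses sent and received.
  have hM := measure_prod_univ_eq_of_map_add_eq_self
    (weightedIntensity P (hΦ.kernel ×ₖ hΨ.kernel) g) (fun s =>
      map_weightedIntensity_eq_self P _ hg (hΦ.measurePreserving s) (by fun_prop)
        (fun ω => by
          rw [hprod, hprod, hΦ.eq_map s ω, hΨ.eq_map s ω, Measure.map_prod_map _ _
            (by fun_prop) (by fun_prop)]
          rfl)
        fun ω y => hF.flowAdapted s ω y.1 y.2) hQ hQ0 hQt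
  rw [weightedIntensity_apply P _ hg (hQ.prod MeasurableSet.univ),
    weightedIntensity_apply P _ hg (MeasurableSet.univ.prod hQ)] at hM
  have hgω : ∀ ω, Measurable fun y : Sp d × Sp d => g (ω, y) := fun ω =>
    hg.comp measurable_prodMk_left
  simp_rw [hprod, ← Measure.prod_restrict, Measure.restrict_univ] at hM
  calc _ = _ := lintegral_congr fun ω => (lintegral_prod _ (hgω ω).aemeasurable).symm
    _ = _ := hM
    _ = _ := lintegral_congr fun ω => lintegral_prod_symm _ (hgω ω).aemeasurable

end Flow

/-! ### The balancing property -/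

section Balancing

variable {Ω : Type*} [MeasurableSpace Ω] {θ : MeasurableFlow d Ω} {P : Measure Ω}
  {Φ Ψ : Ω → Measure (Sp d)} {F : Ω → Sp d → Sp d → ℝ≥0∞}

/-- The expected unused mass of a random measure. -/
def deficitMeasure (hΦ : IsErgodicRandomMeasure θ P Φ) (Ψ : Ω → Measure (Sp d))
    (F : Ω → Sp d → Sp d → ℝ≥0∞) : Measure (Sp d) :=
  weightedIntensity P hΦ.kernel fun p => 1 - ∫⁻ ξ, F p.1 p.2 ξ ∂(Ψ p.1)

lemma IsFlowAdaptedDensity.measurable_deficit (hF : IsFlowAdaptedDensity θ F)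
    (hΨ : IsErgodicRandomMeasure θ P Ψ) :
    Measurable fun p : Ω × Sp d => 1 - ∫⁻ ξ, F p.1 p.2 ξ ∂(Ψ p.1) :=
  measurable_const.sub (hF.measurable_site hΨ)

lemma deficitMeasure_apply (hΦ : IsErgodicRandomMeasure θ P Φ)
    (hΨ : IsErgodicRandomMeasure θ P Ψ) (hF : IsFlowAdaptedDensity θ F) {B : Set (Sp d)}
    (hB : MeasurableSet B) :
    deficitMeasure hΦ Ψ F B = ∫⁻ ω, ∫⁻ x in B, (1 - ∫⁻ ξ, F ω x ξ ∂(Ψ ω)) ∂(Φ ω) ∂P :=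
  have := hΦ.isProbability
  weightedIntensity_apply P hΦ.kernel (hF.measurable_deficit hΨ) hB

lemma map_add_deficitMeasure (hΦ : IsErgodicRandomMeasure θ P Φ)
    (hΨ : IsErgodicRandomMeasure θ P Ψ) (hF : IsFlowAdaptedDensity θ F) (s : Sp d) :
    (deficitMeasure hΦ Ψ F).map (fun x => x + s) = deficitMeasure hΦ Ψ F :=
  have := hΦ.isProbability
  map_weightedIntensity_eq_self P hΦ.kernel (hF.measurable_deficit hΨ) (hΦ.measurePreserving s)
    (by fun_prop) (hΦ.eq_map s) fun ω x => by simp only [hF.lintegral_site_flow hΨ]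

/-- Used and unused mass add up to the intensity. -/
lemma deficitMeasure_add_lintegral (hΦ : IsErgodicRandomMeasure θ P Φ)
    (hΨ : IsErgodicRandomMeasure θ P Ψ) (hF : IsFlowAdaptedDensity θ F)
    (hle : ∀ ω x, ∫⁻ ξ, F ω x ξ ∂(Ψ ω) ≤ 1) {lam : ℝ≥0∞} (hlam : HasIntensity P Φ lam)
    {B : Set (Sp d)} (hB : MeasurableSet B) :
    deficitMeasure hΦ Ψ F B + ∫⁻ ω, ∫⁻ x in B, ∫⁻ ξ, F ω x ξ ∂(Ψ ω) ∂(Φ ω) ∂P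
      = lam * volume B := by
  have hm := hF.measurable_deficit hΨ
  rw [deficitMeasure_apply hΦ hΨ hF hB, ← hlam B hB, ← lintegral_add_left]
  · refine lintegral_congr fun ω => ?_
    have hmω : Measurable fun x => 1 - ∫⁻ ξ, F ω x ξ ∂(Ψ ω) := hm.comp measurable_prodMk_left
    rw [← lintegral_add_left hmω]
    simp_rw [tsub_add_cancel_of_le (hle ω _)]
    exact setLIntegral_one B
  · exact Measurable.setLIntegral_kernel_prod_right (κ := hΦ.kernel)
      (f := fun ω x => 1 - ∫⁻ ξ, F ω x ξ ∂(Ψ ω)) hm hB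

lemma ae_lintegral_eq_one_of_deficitMeasure_eq_zero (hΦ : IsErgodicRandomMeasure θ P Φ)
    (hΨ : IsErgodicRandomMeasure θ P Ψ) (hF : IsFlowAdaptedDensity θ F)
    (hle : ∀ ω x, ∫⁻ ξ, F ω x ξ ∂(Ψ ω) ≤ 1) (h0 : deficitMeasure hΦ Ψ F univ = 0) :
    ∀ᵐ ω ∂P, ∀ᵐ x ∂(Φ ω), ∫⁻ ξ, F ω x ξ ∂(Ψ ω) = 1 := by
  have hm := hF.measurable_deficit hΨ
  rw [deficitMeasure_apply hΦ hΨ hF MeasurableSet.univ] at h0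
  simp_rw [Measure.restrict_univ] at h0
  have hm' : Measurable fun ω => ∫⁻ x, (1 - ∫⁻ ξ, F ω x ξ ∂(Ψ ω)) ∂(Φ ω) :=
    Measurable.lintegral_kernel_prod_right (κ := hΦ.kernel)
      (f := fun ω x => 1 - ∫⁻ ξ, F ω x ξ ∂(Ψ ω)) hm
  filter_upwards [(lintegral_eq_zero_iff hm').1 h0] with ω hω
  have hω' := (lintegral_eq_zero_iff (hm.comp (measurable_prodMk_left (x := ω)))).1 hω
  filter_upwards [hω'] with x hx
  exact le_antisymm (hle ω x) (tsub_eq_zero_iff_le.1 hx)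

/-- Random measures of equal intensity have deficits of equal intensity. -/
lemma deficitMeasure_univ_eq (hΦ : IsErgodicRandomMeasure θ P Φ) (hΨ : IsErgodicRandomMeasure θ P Ψ)
    {lam : ℝ≥0∞} (hlam : lam < ∞) (hΦlam : HasIntensity P Φ lam) (hΨlam : HasIntensity P Ψ lam)
    (hF : IsFlowAdaptedDensity θ F)
    (hsite : ∀ ω x, ∫⁻ ξ, F ω x ξ ∂(Ψ ω) ≤ 1) (hcenter : ∀ ω ξ, ∫⁻ x, F ω x ξ ∂(Φ ω) ≤ 1) :
    deficitMeasure hΦ Ψ F univ = deficitMeasure hΨ Φ (fun ω ξ x => F ω x ξ) univ := by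
  -- Cancelling the transported mass requires it to be finite, hence the comparison on balls before
  -- passing to the whole space. The radius `n + 1` keeps the volume positive at `n = 0`.
  have hball : ∀ n : ℕ, deficitMeasure hΦ Ψ F (Metric.ball 0 (n + 1))
      = deficitMeasure hΨ Φ (fun ω ξ x => F ω x ξ) (Metric.ball 0 (n + 1)) := by
    intro n
    have hB : MeasurableSet (Metric.ball (0 : Sp d) (n + 1)) := measurableSet_ball
    have hv : volume (Metric.ball (0 : Sp d) (n + 1)) ≠ ∞ := measure_ball_lt_top.ne
    have h1 := deficitMeasure_add_lintegral hΦ hΨ hF hsite hΦlam hB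
    have h2 := deficitMeasure_add_lintegral hΨ hΦ hF.swap hcenter hΨlam hB
    rw [← hF.massTransport hΦ hΨ hB (Metric.measure_ball_pos _ _ (by positivity)).ne' hv,
      ← h1] at h2
    refine ((ENNReal.add_left_inj ?_).1 h2).symm
    exact ne_top_of_le_ne_top (ENNReal.mul_ne_top hlam.ne hv) (h1 ▸ le_add_self)
  have hU : ⋃ n : ℕ, Metric.ball (0 : Sp d) (n + 1) = univ := by
    refine eq_univ_of_forall fun y => mem_iUnion.2 ?_
    obtain ⟨n, hn⟩ := exists_nat_gt (dist y 0)
    exact ⟨n, hn.trans (lt_add_one _)⟩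
  have hmono : Monotone fun n : ℕ => Metric.ball (0 : Sp d) (n + 1) := fun m n hmn =>
    Metric.ball_subset_ball (by gcongr)
  rw [← hU, hmono.measure_iUnion, hmono.measure_iUnion]
  exact iSup_congr hball

/-- Either almost surely all sites are exhausted, or almost surely some site is not. -/
lemma deficitMeasure_site_eq_zero_or_ae_exists (hF : IsFlowAdaptedDensity θ F)
    (hΦ : IsErgodicRandomMeasure θ P Φ) (hΨ : IsErgodicRandomMeasure θ P Ψ) :
    deficitMeasure hΦ Ψ F univ = 0 ∨ ∀ᵐ ω ∂P, ∃ x, ∫⁻ ξ, F ω x ξ ∂(Ψ ω) < 1 := by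
  have := hΦ.isProbability
  set D : Ω → ℝ≥0∞ := fun ω => ∫⁻ x, (1 - ∫⁻ ξ, F ω x ξ ∂(Ψ ω)) ∂(Φ ω) with hD
  have hDm : Measurable D := Measurable.lintegral_kernel_prod_right (κ := hΦ.kernel)
    (f := fun ω x => 1 - ∫⁻ ξ, F ω x ξ ∂(Ψ ω)) (hF.measurable_deficit hΨ)
  -- The total deficit `D` of the sites is flow-invariant, so ergodicity applies to the event that
  -- it is nonzero; on that event some site is unexhausted.
  have hDs : ∀ s ω, D (θ s ω) = D ω := by
    intro s ω
    simp only [hD, hF.lintegral_site_flow hΨ, hΦ.flowAdapted]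
    rw [lintegral_shiftMeasure]
    simp_rw [sub_add_cancel]
  have hDu : deficitMeasure hΦ Ψ F univ = ∫⁻ ω, D ω ∂P := by
    rw [deficitMeasure_apply hΦ hΨ hF MeasurableSet.univ]
    simp_rw [Measure.restrict_univ, hD]
  have hset : MeasurableSet {ω | D ω = 0} := hDm (measurableSet_singleton 0)
  rcases hΦ.ergodic {ω | D ω ≠ 0} hset.compl
      (fun s => by ext ω; simp only [mem_preimage, mem_ofPred_eq, hDs]) with h | h
  · left
    rw [hDu, lintegral_eq_zero_iff hDm]
    exact h
  · right
    filter_upwards [(mem_ae_iff_prob_eq_one hset.compl).2 h] with ω hω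
    by_contra! hcon
    refine hω ?_
    simp only [hD, mem_ofPred_eq, tsub_eq_zero_of_le (hcon _), lintegral_zero]

/-- The site-optimal density of two ergodic random measures with the same finite intensity is
almost surely balancing. -/
lemma ae_isBalancing_siteOptimalDensity (hd : 0 < d) (hΦ : IsErgodicRandomMeasure θ P Φ)
    (hΨ : IsErgodicRandomMeasure θ P Ψ) {lam : ℝ≥0∞} (hlam : lam < ∞) (hΦlam : HasIntensity P Φ lam)
    (hΨlam : HasIntensity P Ψ lam) :
    ∀ᵐ ω ∂P, IsBalancing (Φ ω) (Ψ ω) (siteOptimalDensity (Φ ω) (Ψ ω)) := by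
  have := hΦ.isProbability
  have hΦl := hΦ.locallyFinite
  have hΨl := hΨ.locallyFinite
  have hF := isFlowAdaptedDensity_siteOptimalDensity hΦ hΨ
  have hc := fun ω => isConstrained_siteOptimalDensity (Φ ω) (Ψ ω)
  have hsite := fun ω => (hc ω).site_le
  have hcenter := fun ω => (hc ω).center_le
  have heq := deficitMeasure_univ_eq hΦ hΨ hlam hΦlam hΨlam hF hsite hcenter
  have h0 : deficitMeasure hΦ Ψ (fun ω => siteOptimalDensity (Φ ω) (Ψ ω)) univ = 0 := by
    rcases deficitMeasure_site_eq_zero_or_ae_exists hF hΦ hΨ with h | h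
    · exact h
    -- Here the centers are the tractable side: their expected deficit is at most `1`, so it is a
    -- finite translation invariant measure, which vanishes.
    · rw [heq]
      have hle : deficitMeasure hΨ Φ (fun ω ξ x => siteOptimalDensity (Φ ω) (Ψ ω) x ξ) univ
          ≤ 1 := by
        rw [deficitMeasure_apply hΨ hΦ hF.swap MeasurableSet.univ]
        refine (lintegral_mono_ae (g := fun _ => 1) ?_).trans (by simp)
        filter_upwards [h] with ω ⟨x, hx⟩
        rw [Measure.restrict_univ]
        exact lintegral_center_deficit_le_one (Φ ω) (Ψ ω) hx
      have : IsFiniteMeasure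
          (deficitMeasure hΨ Φ (fun ω ξ x => siteOptimalDensity (Φ ω) (Ψ ω) x ξ)) :=
        ⟨hle.trans_lt ENNReal.one_lt_top⟩
      rw [eq_zero_of_map_add_eq_self hd _ (map_add_deficitMeasure hΨ hΦ hF.swap),
        Measure.coe_zero, Pi.zero_apply]
  filter_upwards [ae_lintegral_eq_one_of_deficitMeasure_eq_zero hΦ hΨ hF hsite h0,
    ae_lintegral_eq_one_of_deficitMeasure_eq_zero hΨ hΦ hF.swap hcenter (heq ▸ h0)] with ω h1 h2
  exact ⟨(hc ω).toIsSubBalancing, h1, h2⟩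

end Balancing

end GaleShapley

end

theorem theorem3p5 {d : ℕ} (hd : 0 < d) {Ω : Type*} [MeasurableSpace Ω]
    (θ : GaleShapley.MeasurableFlow d Ω) (ℙ : Measure Ω)
    (Φ Ψ : Ω → Measure (GaleShapley.Sp d))
    (hΦ : GaleShapley.IsErgodicRandomMeasure θ ℙ Φ)
    (hΨ : GaleShapley.IsErgodicRandomMeasure θ ℙ Ψ)
    (lam : ℝ≥0∞) (hlam_pos : 0 < lam) (hlam_fin : lam < ∞)
    (hΦlam : GaleShapley.HasIntensity ℙ Φ lam)
    (hΨlam : GaleShapley.HasIntensity ℙ Ψ lam) :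
    (∀ᵐ ω ∂ℙ,
      GaleShapley.IsConstrained (Φ ω) (Ψ ω) (GaleShapley.siteOptimalDensity (Φ ω) (Ψ ω)) ∧
      GaleShapley.IsBalancing (Φ ω) (Ψ ω) (GaleShapley.siteOptimalDensity (Φ ω) (Ψ ω))) ∧
    GaleShapley.IsFlowAdaptedDensity θ
      (fun ω => GaleShapley.siteOptimalDensity (Φ ω) (Ψ ω)) ∧
    GaleShapley.IsFlowAdaptedKernel θ
      (fun ω => GaleShapley.densityKernel (Ψ ω)
        (GaleShapley.siteOptimalDensity (Φ ω) (Ψ ω))) ∧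
    (∀ᵐ ω ∂ℙ, GaleShapley.IsBalancingTransportKernel (Φ ω) (Ψ ω)
      (GaleShapley.densityKernel (Ψ ω)
        (GaleShapley.siteOptimalDensity (Φ ω) (Ψ ω)))) := by
  have hΦl := hΦ.locallyFinite
  have hΨl := hΨ.locallyFinite
  have hbal := GaleShapley.ae_isBalancing_siteOptimalDensity hd hΦ hΨ hlam_fin hΦlam hΨlam
  have hF := GaleShapley.isFlowAdaptedDensity_siteOptimalDensity hΦ hΨ
  refine ⟨?_, hF, GaleShapley.isFlowAdaptedKernel_densityKernel hΨ hF, ?_⟩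
  -- The constraints hold for every `ω`; only the equalities are almost sure.
  · filter_upwards [hbal] with ω hω
    exact ⟨GaleShapley.isConstrained_siteOptimalDensity _ _, hω⟩
  · filter_upwards [hbal] with ω hω
    exact GaleShapley.isBalancingTransportKernel_of_isBalancing _ _ hω
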